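/- All graphs are finite, simple and undirected. For a graph $G$ with adjacency matrix $A(G)$ and diagonal degree matrix $D(G)$, and $a\ge 0$, let $\rho_a(G)$ denote the largest eigenvalue of $A_a(G)=aD(G)+A(G)$; thus $\rho_0$ is the adjacency spectral radius and $\rho_1$ is the signless Laplacian spectral radius. Let $G_1+G_2$ denote the disjoint union of $G_1$ and $G_2$, let $mK_1$ be the graph with $m$ vertices and no edges, and let the join $G_1\vee G_2$ be obtained from $G_1+G_2$ by adding all edges between $V(G_1)$ and $V(G_2)$. For a spanning tree $T$ of $G$, the leaf degree of a vertex $v$ in $T$ is the number of leaves (vertices of degree one) of $T$ adjacent to $v$ in $T$, and the leaf degree of $T$ is the maximum leaf degree among its vertices. Theorem. Let $k\ge 1$ be an integer, let $a\in\{0,1\}$, and let $G$ be a connected graph of order $n\ge 2k+12$. If $$\rho_a(G)\ \ge\ \rho_a\bigl(K_1\vee(K_{n-k-2}+(k+1)K_1)\bigr),$$ then $G$ has a spanning tree with leaf degree at most $k$ unless $G\cong K_1\vee(K_{n-k-2}+(k+1)K_1)$, and in this exceptional case $G$ has no such spanning tree. That is, $G$ has a spanning tree with leaf degree at most $k$ if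 and only if $G\not\cong K_1\vee(K_{n-k-2}+(k+1)K_1)$. -/

import Mathlib

/-- The join `G₁ ∨ G₂` of two vertex-disjoint graphs: their disjoint union together with all edges
between the two parts. -/
def graphJoin {V W : Type*} (G : SimpleGraph V) (H : SimpleGraph W) : SimpleGraph (V ⊕ W) where
  Adj
    | .inl u, .inl v => G.Adj u v
    | .inr u, .inr v => H.Adj u v
    | .inl _, .inr _ => True
    | .inr _, .inl _ => True
  symm := ⟨by
    rintro (u | u) (v | v) h
    · exact G.adj_symm h
    · trivial
    · trivial
    · exact H.adj_symm h⟩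
  loopless := ⟨by
    rintro (u | u) h
    · exact G.irrefl h
    · exact H.irrefl h⟩

/-- The graph `K₁ ∨ (K_{n-k-2} + (k+1)K₁)`; it has order `n` when `k + 2 ≤ n`. -/
def extremalGraph (n k : ℕ) : SimpleGraph (Fin 1 ⊕ (Fin (n - k - 2) ⊕ Fin (k + 1))) :=
  graphJoin (⊤ : SimpleGraph (Fin 1))
    ((⊤ : SimpleGraph (Fin (n - k - 2))).sum (⊥ : SimpleGraph (Fin (k + 1))))

open Classical in
/-- The matrix `A_a(G) = a D(G) + A(G)`. -/
noncomputable def aMatrix {V : Type*} [Fintype V] (a : ℝ) (G : SimpleGraph V) : Matrix V V ℝ :=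
  a • G.degMatrix ℝ + G.adjMatrix ℝ

/-- `A_a(G)` is a real symmetric matrix. -/
theorem aMatrix_isHermitian {V : Type*} [Fintype V] (a : ℝ) (G : SimpleGraph V) :
    (aMatrix a G).IsHermitian := by
  classical
  ext i j
  simp only [aMatrix, SimpleGraph.degMatrix, SimpleGraph.adjMatrix, Matrix.conjTranspose_apply,
    Matrix.add_apply, Matrix.smul_apply, Matrix.diagonal_apply, Matrix.of_apply, star_trivial,
    smul_eq_mul, SimpleGraph.adj_comm G j i]
  by_cases h : i = j
  · subst h; rfl
  · simp [h, Ne.symm h]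

/-- The `A_a`-spectral radius of `G`: the largest eigenvalue of `A_a(G)`. -/
noncomputable def rhoA {V : Type*} [Fintype V] (a : ℝ) (G : SimpleGraph V) : ℝ :=
  sSup {μ : ℝ | Module.End.HasEigenvalue (Matrix.mulVecLin (aMatrix a G)) μ}

/-- The supremum in the definition of `rhoA` is attained as soon as there is a vertex. -/
theorem rhoA_isGreatest {V : Type*} [Fintype V] [Nonempty V] (a : ℝ) (G : SimpleGraph V) :
    IsGreatest {μ : ℝ | Module.End.HasEigenvalue (Matrix.mulVecLin (aMatrix a G)) μ}
      (rhoA a G) := by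
  classical
  have hfin : {μ : ℝ | Module.End.HasEigenvalue (Matrix.mulVecLin (aMatrix a G)) μ}.Finite :=
    Module.End.finite_hasEigenvalue _
  have hne : {μ : ℝ | Module.End.HasEigenvalue (Matrix.mulVecLin (aMatrix a G)) μ}.Nonempty := by
    have hA := aMatrix_isHermitian a G
    obtain ⟨i⟩ := ‹Nonempty V›
    refine ⟨hA.eigenvalues i, Module.End.hasEigenvalue_iff_mem_spectrum.2 ?_⟩
    have h := hA.eigenvalues_mem_spectrum_real i
    rw [← Matrix.spectrum_toLin'] at h
    exact h
  exact ⟨hne.csSup_mem hfin, fun _ h => le_csSup hfin.bddAbove h⟩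

open Classical in
/-- The leaf degree of the vertex `v` in `T`: the number of leaves (vertices of degree one) of `T`
that are adjacent to `v` in `T`. -/
noncomputable def vertexLeafDegree {V : Type*} [Fintype V] (T : SimpleGraph V) (v : V) : ℕ :=
  (Finset.univ.filter fun u => T.Adj v u ∧ T.degree u = 1).card

/-- The leaf degree of `T`: the maximum of the leaf degrees of its vertices. -/
noncomputable def leafDegree {V : Type*} [Fintype V] (T : SimpleGraph V) : ℕ :=
  Finset.univ.sup fun v => vertexLeafDegree T v

/-- `T` is a spanning tree of `G`: a tree on the vertex set of `G` all of whose edges belong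
to `G`. -/
def IsSpanningTree {V : Type*} (G T : SimpleGraph V) : Prop :=
  T ≤ G ∧ T.IsTree

/-!
# Spanning trees of bounded leaf degree and the `A_a`-spectral radius

The theorem combines Kaneko's combinatorial criterion with two spectral comparisons.

*Kaneko's criterion.* If every nonempty vertex set `S` isolates fewer than `(k + 1)|S|` vertices of a
connected graph, then the graph has a spanning tree of leaf degree at most `k`
(`IsolatesFewerThan.exists_isSpanningTree`). It suffices to find a spanning forest without isolated
vertices of leaf degree at most `k`, since extending such a forest to a tree creates no leaves.
Hall's theorem gives a map `g` sending each vertex to a neighbour, with fibres of size at most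
`k + 1`, and an extremal argument turns `g` into a spanning family of stars with at most `k + 1`
leaves each (`exists_isStarPacking_cover`). Next, consider the spanning forests of leaf degree at most
`k + 1` in which the component of every full vertex, one with `k + 1` leaves, is a star. Joining a
leaf of a full star to a vertex outside the star that is not full decreases the number of full
vertices. So in a forest with the fewest full vertices, the leaves of the full stars have only full
vertices as neighbours, and the full vertices would violate the criterion if there were any
(`IsStarredForest.fullVertices_eq_empty`). Two leaves of the same full star may be adjacent. For
`k ≥ 2` this, too, allows a decrease; for `k = 1` the star then spans a triangle, whose centre can be
chosen freely (`IsStarredForest.exists_rotate`), and such stars are left out of the violating set.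

*Spectral comparison.* If `G` has no such tree, some `S` isolates `(k + 1)|S|` vertices. For `|S| = 1`
this makes `G` a spanning subgraph of the extremal graph, and a proper connected one has smaller
spectral radius by Perron's theorem (`rhoA_lt_of_bijective`). For `|S| ≥ 2` a test vector with three
values shows `ρ_a(G) ≤ (1 + a)(n - k - 2)` (`rhoA_le_of_two_le_card`), the value at the complete graph
of order `n - k - 1`, which the extremal graph properly contains (`lt_rhoA_extremalGraph`).

Conversely, the `k + 1` pendant vertices of the extremal graph are leaves of each of its spanning
trees, all at the same vertex (`lt_leafDegree_of_iso_extremalGraph`).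
-/

/-! ### Hall's theorem and star packings -/

section StarFactor
open Classical
open Finset

variable {V : Type*} [Fintype V]

/-- Kaneko's condition: every nonempty vertex set `S` isolates fewer than `(k + 1)|S|` vertices.
Here `I` ranges over the sets of vertices outside `S` that are isolated in `G - S`. -/
def IsolatesFewerThan (G : SimpleGraph V) (k : ℕ) : Prop :=
  ∀ S I : Finset V, S.Nonempty → Disjoint I S → (∀ u ∈ I, ∀ w, G.Adj u w → w ∈ S) →
    I.card < (k + 1) * S.card

/-- A relaxed form of a star factor, obtained from Hall's theorem with `k + 1` copies of each vertex.
Hall's condition `|X| ≤ (k + 1)|N(X)|` holds for every vertex set `X`: the set `X₀` of members of `X`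
without a neighbour in `X` is isolated by `N(X₀)`, and the rest of `X` lies in `N(X) \ N(X₀)`. -/
lemma IsolatesFewerThan.exists_neighbor_map {G : SimpleGraph V} {k : ℕ}
    (hK : IsolatesFewerThan G k) (hiso : ∀ v, ∃ w, G.Adj v w) :
    ∃ g : V → V, (∀ v, G.Adj v (g v)) ∧ ∀ s, #{v | g v = s} ≤ k + 1 := by
  let t : V → Finset (V × Fin (k + 1)) := fun v => (univ.filter (G.Adj v)) ×ˢ univ
  have hall : ∀ X : Finset V, X.card ≤ (X.biUnion t).card := by
    intro X
    set N : Finset V := univ.filter fun w => ∃ v ∈ X, G.Adj v w with hN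
    have hbi : X.biUnion t = N ×ˢ (univ : Finset (Fin (k + 1))) := by
      ext ⟨w, i⟩; simp [t, hN]
    rw [hbi, card_product, card_univ, Fintype.card_fin]
    set X₀ : Finset V := X.filter fun v => ∀ w ∈ X, ¬ G.Adj v w with hX₀
    set N₀ : Finset V := univ.filter fun w => ∃ v ∈ X₀, G.Adj v w with hN₀
    have hX₀le : X₀.card ≤ (k + 1) * N₀.card := by
      rcases X₀.eq_empty_or_nonempty with h | ⟨v, hv⟩
      · simp [h]
      · obtain ⟨w, hw⟩ := hiso v
        refine (hK N₀ X₀ ⟨w, by simp only [hN₀, mem_filter, mem_univ, true_and]; exact ⟨v, hv, hw⟩⟩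
          ?_ ?_).le
        · rw [Finset.disjoint_left]
          rintro u hu hu'
          simp only [hN₀, hX₀, mem_filter, mem_univ, true_and] at hu hu'
          obtain ⟨x, hx, hxu⟩ := hu'
          exact hx.2 u hu.1 hxu
        · intro u hu w huw
          simp only [hN₀, mem_filter, mem_univ, true_and]
          exact ⟨u, hu, huw⟩
    have hN₀N : N₀ ⊆ N := by
      intro w
      simp only [hN₀, hN, hX₀, mem_filter, mem_univ, true_and]
      rintro ⟨v, hv, hvw⟩
      exact ⟨v, hv.1, hvw⟩
    have hrest : X \ X₀ ⊆ N \ N₀ := by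
      intro x
      simp only [hN₀, hN, hX₀, mem_filter, mem_univ, true_and, mem_sdiff, not_and, not_forall,
        not_not]
      rintro ⟨hx, h⟩
      obtain ⟨w, hw, hxw⟩ := h hx
      refine ⟨⟨w, hw, hxw.symm⟩, ?_⟩
      rintro ⟨v, ⟨_, hv⟩, hvx⟩
      exact hv x hx hvx
    have h1 := card_le_card hrest
    have h2 := card_sdiff_add_card_eq_card hN₀N
    have h3 : #(X \ X₀) + #X₀ = #X := card_sdiff_add_card_eq_card (filter_subset _ _)
    nlinarith
  obtain ⟨F, hFinj, hF⟩ := (Finset.all_card_le_biUnion_card_iff_exists_injective t).1 hall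
  refine ⟨fun v => (F v).1, fun v => ?_, fun s => ?_⟩
  · have := hF v
    simp only [t, mem_product, mem_filter, mem_univ, true_and, and_true] at this
    exact this
  · have : #{v | (F v).1 = s} ≤ #(univ : Finset (Fin (k + 1))) := by
      refine card_le_card_of_injOn (fun v => (F v).2) (fun _ _ => mem_univ _) ?_
      intro x hx y hy hxy
      simp only [coe_filter, mem_univ, true_and, Set.mem_ofPred_eq] at hx hy
      exact hFinj (Prod.ext (hx.trans hy.symm) hxy)
    simpa using this

/-- A packing of vertex-disjoint stars with at most `m` leaves each: `A` is the set of leaves, and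
`f` sends a leaf to its centre. A star with one leaf is an edge with one end in `A`. -/
structure IsStarPacking (G : SimpleGraph V) (m : ℕ) (A : Finset V) (f : V → V) : Prop where
  center_notMem : ∀ a ∈ A, f a ∉ A
  adj : ∀ a ∈ A, G.Adj a (f a)
  card_le : ∀ s, #{a ∈ A | f a = s} ≤ m

/-- A graph with a neighbour map whose fibres have at most `m ≥ 2` elements has a spanning star
packing with at most `m` leaves per star. Take a packing covering as many vertices as possible,
and among these one whose centre map agrees with the neighbour map as often as possible. -/
lemma exists_isStarPacking_cover {G : SimpleGraph V} {m : ℕ} (hm : 2 ≤ m) (g : V → V)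
    (hg : ∀ v, G.Adj v (g v)) (hfib : ∀ s, #{v | g v = s} ≤ m) :
    ∃ A f, IsStarPacking G m A f ∧ ∀ v, v ∈ A ∨ ∃ a ∈ A, f a = v := by
  let cov : Finset V × (V → V) → Finset V := fun p => p.1 ∪ p.1.image p.2
  let agr : Finset V × (V → V) → Finset V := fun p => p.1.filter fun a => p.2 a = g a
  let val : Finset V × (V → V) → ℕ :=
    fun p => (Fintype.card V + 1) * (cov p).card + (agr p).card
  have hagr : ∀ p, (agr p).card ≤ Fintype.card V := fun p => card_le_univ _
  obtain ⟨⟨A, f⟩, hP, hmax⟩ := Set.exists_max_image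
    {p : Finset V × (V → V) | IsStarPacking G m p.1 p.2} val (Set.toFinite _)
    ⟨(∅, id), ⟨by simp, by simp, by simp⟩⟩
  simp only [Set.mem_ofPred_eq] at hP hmax
  refine ⟨A, f, hP, ?_⟩
  by_contra hcon
  push Not at hcon
  obtain ⟨y, hyA, hyf⟩ := hcon
  have hAy : ∀ a ∈ A, a ≠ y := fun a ha h => hyA (h ▸ ha)
  have hycov : y ∉ cov (A, f) := by
    simp only [cov, mem_union, mem_image, not_or, not_exists, not_and]
    exact ⟨hyA, fun a ha => hyf a ha⟩
  -- No packing covers strictly more vertices.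
  have hmaxcov : ∀ A' f', IsStarPacking G m A' f' → cov (A, f) ⊆ cov (A', f') →
      y ∉ cov (A', f') := by
    intro A' f' hP' hsub hy
    have h1 := hmax (A', f') hP'
    have h2 : (cov (A, f)).card < (cov (A', f')).card :=
      card_lt_card ⟨hsub, fun h => hycov (h hy)⟩
    have h3 := hagr (A, f)
    simp only [val] at h1
    nlinarith
  set w := g y with hw
  have hyw : G.Adj y w := hg y
  have hne : y ≠ w := hyw.ne
  by_cases hwA : w ∈ A
  · set c := f w with hc
    have hcA : c ∉ A := hP.center_notMem w hwA
    have hcw : c ≠ w := fun h => hcA (h ▸ hwA)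
    have hcy : c ≠ y := fun h => hyf w hwA h
    by_cases hother : ∃ a ∈ A, a ≠ w ∧ f a = c
    · -- `w` is a leaf of a star with another leaf: match `y` with `w`.
      obtain ⟨b, hbA, hbw, hbc⟩ := hother
      refine hmaxcov (insert y (A.erase w)) (Function.update f y w) ⟨?_, ?_, ?_⟩ ?_ ?_
      · intro a ha
        rcases mem_insert.1 ha with rfl | ha
        · simp [hne.symm]
        · have hay : a ≠ y := hAy a (mem_of_mem_erase ha)
          rw [Function.update_of_ne hay]
          intro h
          rcases mem_insert.1 h with h | h
          · exact hyf a (mem_of_mem_erase ha) h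
          · exact hP.center_notMem a (mem_of_mem_erase ha) (mem_of_mem_erase h)
      · intro a ha
        rcases mem_insert.1 ha with rfl | ha
        · simpa using hyw
        · have hay : a ≠ y := hAy a (mem_of_mem_erase ha)
          rw [Function.update_of_ne hay]
          exact hP.adj a (mem_of_mem_erase ha)
      · intro s
        by_cases hs : s = w
        · calc _ ≤ #({y} : Finset V) := by
                refine card_le_card fun a ha => ?_
                obtain ⟨ha, h⟩ := mem_filter.1 ha
                rcases mem_insert.1 ha with rfl | ha
                · simp
                · have hay : a ≠ y := hAy a (mem_of_mem_erase ha)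
                  rw [Function.update_of_ne hay, hs] at h
                  exact absurd (h ▸ hwA) (hP.center_notMem a (mem_of_mem_erase ha))
            _ ≤ m := by simp; omega
        · refine (card_le_card fun a ha => ?_).trans (hP.card_le s)
          obtain ⟨ha, h⟩ := mem_filter.1 ha
          rcases mem_insert.1 ha with rfl | ha
          · simp at h; exact absurd h.symm hs
          · have hay : a ≠ y := hAy a (mem_of_mem_erase ha)
            rw [Function.update_of_ne hay] at h
            exact mem_filter.2 ⟨mem_of_mem_erase ha, h⟩
      · intro v hv
        simp only [cov, mem_union, mem_image, mem_insert, mem_erase] at hv ⊢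
        rcases hv with hv | ⟨a, ha, rfl⟩
        · by_cases hvw : v = w
          · exact Or.inr ⟨y, Or.inl rfl, by simp [hvw]⟩
          · exact Or.inl (Or.inr ⟨hvw, hv⟩)
        · right
          by_cases haw : a = w
          · refine ⟨b, Or.inr ⟨hbw, hbA⟩, ?_⟩
            rw [Function.update_of_ne (hAy b hbA), hbc, hc, haw]
          · exact ⟨a, Or.inr ⟨haw, ha⟩, Function.update_of_ne (hAy a ha) _ _⟩
      · simp [cov]
    · -- `w` is an end of a one-edge star: turn it into the centre of a star with two leaves.
      push Not at hother
      refine hmaxcov (insert c (insert y (A.erase w)))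
        (Function.update (Function.update f y w) c w) ⟨?_, ?_, ?_⟩ ?_ ?_
      · intro a ha
        rcases mem_insert.1 ha with rfl | ha
        · simp [hcw.symm, hne.symm]
        rcases mem_insert.1 ha with rfl | ha
        · simp [hcy.symm, hcw.symm, hne.symm]
        · have haA := mem_of_mem_erase ha
          have hay : a ≠ y := hAy a haA
          have hac : a ≠ c := fun h => hcA (h ▸ haA)
          rw [Function.update_of_ne hac, Function.update_of_ne hay]
          intro h
          rcases mem_insert.1 h with h | h
          · exact hother a haA (ne_of_mem_erase ha) h
          rcases mem_insert.1 h with h | h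
          · exact hyf a haA h
          · exact hP.center_notMem a haA (mem_of_mem_erase h)
      · intro a ha
        rcases mem_insert.1 ha with rfl | ha
        · simpa using (hP.adj w hwA).symm
        rcases mem_insert.1 ha with rfl | ha
        · simpa [hcy.symm] using hyw
        · have haA := mem_of_mem_erase ha
          have hay : a ≠ y := hAy a haA
          have hac : a ≠ c := fun h => hcA (h ▸ haA)
          rw [Function.update_of_ne hac, Function.update_of_ne hay]
          exact hP.adj a haA
      · intro s
        by_cases hs : s = w
        · calc _ ≤ #({c, y} : Finset V) := by
                refine card_le_card fun a ha => ?_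
                obtain ⟨ha, h⟩ := mem_filter.1 ha
                rcases mem_insert.1 ha with rfl | ha
                · simp
                rcases mem_insert.1 ha with rfl | ha
                · simp
                · have haA := mem_of_mem_erase ha
                  have hay : a ≠ y := hAy a haA
                  have hac : a ≠ c := fun h => hcA (h ▸ haA)
                  rw [Function.update_of_ne hac, Function.update_of_ne hay, hs] at h
                  exact absurd (h ▸ hwA) (hP.center_notMem a haA)
            _ ≤ m := card_le_two.trans hm
        · refine (card_le_card fun a ha => ?_).trans (hP.card_le s)
          obtain ⟨ha, h⟩ := mem_filter.1 ha
          rcases mem_insert.1 ha with rfl | ha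
          · simp at h; exact absurd h.symm hs
          rcases mem_insert.1 ha with rfl | ha
          · simp [hcy.symm] at h; exact absurd h.symm hs
          · have haA := mem_of_mem_erase ha
            have hay : a ≠ y := hAy a haA
            have hac : a ≠ c := fun h => hcA (h ▸ haA)
            rw [Function.update_of_ne hac, Function.update_of_ne hay] at h
            exact mem_filter.2 ⟨haA, h⟩
      · intro v hv
        simp only [cov, mem_union, mem_image, mem_insert, mem_erase] at hv ⊢
        rcases hv with hv | ⟨a, ha, rfl⟩
        · by_cases hvw : v = w
          · exact Or.inr ⟨c, Or.inl rfl, by simp [hvw]⟩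
          · exact Or.inl (Or.inr (Or.inr ⟨hvw, hv⟩))
        · by_cases haw : a = w
          · exact Or.inl (Or.inl (by rw [haw]))
          · have hay : a ≠ y := hAy a ha
            have hac : a ≠ c := fun h => hcA (h ▸ ha)
            exact Or.inr ⟨a, Or.inr (Or.inr ⟨haw, ha⟩), by
              rw [Function.update_of_ne hac, Function.update_of_ne hay]⟩
      · simp [cov]
  · by_cases hlt : #{a ∈ A | f a = w} < m
    · -- The star at `w`, possibly empty, has room for `y`.
      refine hmaxcov (insert y A) (Function.update f y w) ⟨?_, ?_, ?_⟩ ?_ ?_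
      · intro a ha
        rcases mem_insert.1 ha with rfl | ha
        · simp [hne.symm, hwA]
        · have hay : a ≠ y := hAy a ha
          rw [Function.update_of_ne hay]
          intro h
          rcases mem_insert.1 h with h | h
          · exact hyf a ha h
          · exact hP.center_notMem a ha h
      · intro a ha
        rcases mem_insert.1 ha with rfl | ha
        · simpa using hyw
        · have hay : a ≠ y := hAy a ha
          rw [Function.update_of_ne hay]
          exact hP.adj a ha
      · intro s
        by_cases hs : s = w
        · refine (card_le_card (t := insert y {a ∈ A | f a = w}) fun a ha => ?_).trans
            ((card_insert_le _ _).trans hlt)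
          obtain ⟨ha, h⟩ := mem_filter.1 ha
          rcases mem_insert.1 ha with rfl | ha
          · simp
          · have hay : a ≠ y := hAy a ha
            rw [Function.update_of_ne hay, hs] at h
            exact mem_insert_of_mem (mem_filter.2 ⟨ha, h⟩)
        · refine (card_le_card fun a ha => ?_).trans (hP.card_le s)
          obtain ⟨ha, h⟩ := mem_filter.1 ha
          rcases mem_insert.1 ha with rfl | ha
          · simp at h; exact absurd h.symm hs
          · have hay : a ≠ y := hAy a ha
            rw [Function.update_of_ne hay] at h
            exact mem_filter.2 ⟨ha, h⟩
      · intro v hv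
        simp only [cov, mem_union, mem_image, mem_insert] at hv ⊢
        rcases hv with hv | ⟨a, ha, rfl⟩
        · exact Or.inl (Or.inr hv)
        · exact Or.inr ⟨a, Or.inr ha, Function.update_of_ne (hAy a ha) _ _⟩
      · simp [cov]
    · -- The star at `w` is full. As `g y = w`, one of its `m` leaves `u` has `g u ≠ w`; replacing
      -- `u` by `y` keeps the coverage and increases the agreement with `g`.
      have hex : ∃ u ∈ A, f u = w ∧ g u ≠ w := by
        by_contra hno
        push Not at hno
        have hsub : insert y {a ∈ A | f a = w} ⊆ ({v | g v = w} : Finset V) := by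
          intro v hv
          rcases mem_insert.1 hv with rfl | hv
          · simp [hw]
          · obtain ⟨h1, h2⟩ := mem_filter.1 hv
            simp [hno v h1 h2]
        have := (card_le_card hsub).trans (hfib w)
        rw [card_insert_of_notMem (fun h => hyA (mem_filter.1 h).1)] at this
        omega
      obtain ⟨u, huA, hfu, hgu⟩ := hex
      have huw : u ≠ w := fun h => hwA (h ▸ huA)
      have huy : u ≠ y := fun h => hyA (h ▸ huA)
      have hP' : IsStarPacking G m (insert y (A.erase u)) (Function.update f y w) := by
        refine ⟨?_, ?_, ?_⟩
        · intro a ha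
          rcases mem_insert.1 ha with rfl | ha
          · simp [hne.symm, hwA]
          · have haA := mem_of_mem_erase ha
            have hay : a ≠ y := hAy a haA
            rw [Function.update_of_ne hay]
            intro h
            rcases mem_insert.1 h with h | h
            · exact hyf a haA h
            · exact hP.center_notMem a haA (mem_of_mem_erase h)
        · intro a ha
          rcases mem_insert.1 ha with rfl | ha
          · simpa using hyw
          · have haA := mem_of_mem_erase ha
            have hay : a ≠ y := hAy a haA
            rw [Function.update_of_ne hay]
            exact hP.adj a haA
        · intro s
          by_cases hs : s = w
          · have hsub : (({a ∈ insert y (A.erase u) | Function.update f y w a = s}) : Finset V) ⊆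
                insert y (({a ∈ A | f a = w} : Finset V).erase u) := by
              intro a ha
              obtain ⟨ha, h⟩ := mem_filter.1 ha
              rcases mem_insert.1 ha with rfl | ha
              · simp
              · have haA := mem_of_mem_erase ha
                have hay : a ≠ y := hAy a haA
                rw [Function.update_of_ne hay, hs] at h
                exact mem_insert_of_mem (mem_erase.2 ⟨ne_of_mem_erase ha, mem_filter.2 ⟨haA, h⟩⟩)
            have h1 := (card_le_card hsub).trans (card_insert_le _ _)
            have h2 := card_erase_add_one (mem_filter.2 ⟨huA, hfu⟩ :
              u ∈ ({a ∈ A | f a = w} : Finset V))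
            have h3 := hP.card_le w
            omega
          · refine (card_le_card fun a ha => ?_).trans (hP.card_le s)
            obtain ⟨ha, h⟩ := mem_filter.1 ha
            rcases mem_insert.1 ha with rfl | ha
            · simp at h; exact absurd h.symm hs
            · have haA := mem_of_mem_erase ha
              have hay : a ≠ y := hAy a haA
              rw [Function.update_of_ne hay] at h
              exact mem_filter.2 ⟨haA, h⟩
      have hcov : (cov (A, f)).card ≤ (cov (insert y (A.erase u), Function.update f y w)).card := by
        have hsub : insert y ((cov (A, f)).erase u) ⊆
            cov (insert y (A.erase u), Function.update f y w) := by
          intro v hv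
          simp only [cov, mem_union, mem_image, mem_insert, mem_erase] at hv ⊢
          rcases hv with rfl | ⟨hvu, hv | ⟨a, ha, rfl⟩⟩
          · simp
          · exact Or.inl (Or.inr ⟨hvu, hv⟩)
          · right
            by_cases hau : a = u
            · exact ⟨y, Or.inl rfl, by simp [hau, hfu]⟩
            · exact ⟨a, Or.inr ⟨hau, ha⟩, Function.update_of_ne (hAy a ha) _ _⟩
        have h1 := card_le_card hsub
        rw [card_insert_of_notMem (fun h => hycov (mem_of_mem_erase h)),
          card_erase_add_one (by simp [cov, huA])] at h1
        exact h1
      have hagr' : (agr (A, f)).card <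
          (agr (insert y (A.erase u), Function.update f y w)).card := by
        refine card_lt_card ⟨fun a ha => ?_, fun h => hyA (mem_filter.1 (@h y ?_)).1⟩
        · obtain ⟨ha, h⟩ := mem_filter.1 ha
          have hay : a ≠ y := hAy a ha
          refine mem_filter.2 ⟨mem_insert_of_mem (mem_erase.2 ⟨?_, ha⟩), ?_⟩
          · rintro rfl
            exact hgu (h ▸ hfu)
          · simpa [Function.update_of_ne hay] using h
        · exact mem_filter.2 ⟨mem_insert_self _ _, by simp [hw]⟩
      have := hmax (insert y (A.erase u), Function.update f y w) hP'
      simp only [val] at this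
      nlinarith

end StarFactor

/-! ### Leaf degrees and starred forests -/

section LeafDegree
open Classical
open Finset

variable {V : Type*} [Fintype V]

/-- The neighbours of `v` in `F` whose only neighbour is `v`. -/
noncomputable def leafNeighbors (F : SimpleGraph V) (v : V) : Finset V :=
  {u | F.Adj v u ∧ ∀ w, F.Adj u w → w = v}

lemma mem_leafNeighbors {F : SimpleGraph V} {u v : V} :
    u ∈ leafNeighbors F v ↔ F.Adj v u ∧ ∀ w, F.Adj u w → w = v := by
  simp [leafNeighbors]

lemma vertexLeafDegree_eq_card_leafNeighbors (T : SimpleGraph V) (v : V) :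
    vertexLeafDegree T v = #(leafNeighbors T v) := by
  unfold vertexLeafDegree
  congr 1
  ext u
  simp only [mem_filter, mem_univ, true_and, mem_leafNeighbors]
  refine and_congr_right fun h => ?_
  rw [SimpleGraph.degree_eq_one_iff_existsUnique_adj]
  constructor
  · rintro ⟨x, _, hx⟩ w hw
    rw [hx w hw, hx v h.symm]
  · exact fun hu => ⟨v, h.symm, hu⟩

/-- Adding edges to a graph without isolated vertices creates no new leaves. -/
lemma leafNeighbors_subset_of_le {F F' : SimpleGraph V} (hle : F ≤ F')
    (hF : ∀ v, ∃ w, F.Adj v w) (v : V) : leafNeighbors F' v ⊆ leafNeighbors F v := by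
  intro u hu
  rw [mem_leafNeighbors] at hu ⊢
  obtain ⟨w, hw⟩ := hF u
  obtain rfl := hu.2 w (hle hw)
  exact ⟨hw.symm, fun x hx => hu.2 x (hle hx)⟩

/-- A vertex with a leaf neighbour is the only possible leaf neighbour of that leaf. -/
lemma leafNeighbors_subset_singleton {F : SimpleGraph V} {s u : V} (hu : u ∈ leafNeighbors F s) :
    leafNeighbors F u ⊆ {s} := by
  intro x hx
  rw [mem_leafNeighbors] at hu hx
  exact mem_singleton.2 (hu.2 x hx.1)

/-- An acyclic subgraph without isolated vertices extends to a spanning tree of no larger leaf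
degree. -/
lemma exists_isSpanningTree_leafDegree_le {G F : SimpleGraph V} {k : ℕ} (hG : G.Connected)
    (hle : F ≤ G) (hac : F.IsAcyclic) (hF : ∀ v, ∃ w, F.Adj v w)
    (hk : ∀ v, #(leafNeighbors F v) ≤ k) :
    ∃ T : SimpleGraph V, IsSpanningTree G T ∧ leafDegree T ≤ k := by
  obtain ⟨T, hFT, hTG, hT⟩ := hG.exists_isTree_le_of_le_of_isAcyclic hle hac
  refine ⟨T, ⟨hTG, hT⟩, Finset.sup_le fun v _ => ?_⟩
  rw [vertexLeafDegree_eq_card_leafNeighbors]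
  exact (card_le_card (leafNeighbors_subset_of_le hFT hF v)).trans (hk v)

lemma not_reachable_of_closed {W : Type*} {F : SimpleGraph W} (C : Set W)
    (hC : ∀ a ∈ C, ∀ b, F.Adj a b → b ∈ C) {u w : W} (hu : u ∈ C) (hw : w ∉ C) :
    ¬ F.Reachable u w := by
  rintro ⟨p⟩
  induction p with
  | nil => exact hw hu
  | cons h _ ih => exact ih (hC _ hu _ h) hw

lemma isAcyclic_of_forall_adj_leaf {W : Type*} {F : SimpleGraph W}
    (h : ∀ u v, F.Adj u v → (∀ w, F.Adj u w → w = v) ∨ ∀ w, F.Adj v w → w = u) :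
    F.IsAcyclic := by
  rw [SimpleGraph.isAcyclic_iff_forall_adj_isBridge]
  -- After removal of a pendant edge its leaf is isolated.
  have key : ∀ u v, F.Adj u v → (∀ w, F.Adj u w → w = v) → F.IsBridge s(u, v) := by
    intro u v huv hu
    rw [SimpleGraph.isBridge_iff]
    refine not_reachable_of_closed {u} ?_ rfl huv.ne'
    rintro a rfl b hab
    rw [SimpleGraph.deleteEdges_adj, Set.mem_singleton_iff] at hab
    exact absurd (by rw [hu b hab.1]) hab.2
  intro u v huv
  rcases h u v huv with h | h
  · exact key u v huv h
  · rw [Sym2.eq_swap]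
    exact key v u huv.symm h

/-- A spanning forest of `G` without isolated vertices, of leaf degree at most `k + 1`, in which the
component of every vertex of leaf degree `k + 1` is a star. -/
structure IsStarredForest (G F : SimpleGraph V) (k : ℕ) : Prop where
  le : F ≤ G
  isAcyclic : F.IsAcyclic
  exists_adj : ∀ v, ∃ w, F.Adj v w
  card_le : ∀ v, #(leafNeighbors F v) ≤ k + 1
  full : ∀ s, #(leafNeighbors F s) = k + 1 → ∀ u, F.Adj s u → u ∈ leafNeighbors F s

/-- The vertices with `k + 1` leaf neighbours, called full below. -/
noncomputable def fullVertices (F : SimpleGraph V) (k : ℕ) : Finset V :=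
  {s | #(leafNeighbors F s) = k + 1}

lemma mem_fullVertices {F : SimpleGraph V} {k : ℕ} {s : V} :
    s ∈ fullVertices F k ↔ #(leafNeighbors F s) = k + 1 := by
  simp [fullVertices]

lemma notMem_fullVertices_of_mem_leafNeighbors {F : SimpleGraph V} {k : ℕ} (hk : 1 ≤ k) {s u : V}
    (hu : u ∈ leafNeighbors F s) : u ∉ fullVertices F k := by
  intro h
  have h1 := card_le_card (leafNeighbors_subset_singleton hu)
  rw [mem_fullVertices.1 h, card_singleton] at h1
  omega

lemma IsStarPacking.exists_isStarredForest {G : SimpleGraph V} {k : ℕ} (hk : 1 ≤ k) {A : Finset V}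
    {f : V → V} (hP : IsStarPacking G (k + 1) A f) (hcov : ∀ v, v ∈ A ∨ ∃ a ∈ A, f a = v) :
    ∃ F, IsStarredForest G F k := by
  let F : SimpleGraph V :=
    { Adj := fun u v => (u ∈ A ∧ f u = v) ∨ (v ∈ A ∧ f v = u)
      symm := ⟨fun u v h => h.symm⟩
      loopless := ⟨fun u h => by
        rcases h with ⟨h, e⟩ | ⟨h, e⟩ <;> exact hP.center_notMem u h (e.symm ▸ h)⟩ }
  have hleaf : ∀ a ∈ A, ∀ w, F.Adj a w → w = f a := by
    rintro a ha w (⟨_, h⟩ | ⟨hw, h⟩)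
    · exact h.symm
    · exact absurd (h.symm ▸ ha) (hP.center_notMem w hw)
  have hcenter : ∀ v ∉ A, ∀ u, F.Adj v u → u ∈ A ∧ f u = v := by
    rintro v hv u (⟨h, _⟩ | h)
    · exact absurd h hv
    · exact h
  have hleafset : ∀ v ∈ A, #(leafNeighbors F v) ≤ 1 := by
    intro v hv
    refine (card_le_card (t := {f v}) fun x hx => ?_).trans (card_singleton _).le
    exact mem_singleton.2 (hleaf v hv x (mem_leafNeighbors.1 hx).1)
  refine ⟨F, ⟨?_, ?_, ?_, ?_, ?_⟩⟩
  · rintro u v (⟨h, rfl⟩ | ⟨h, rfl⟩)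
    · exact hP.adj u h
    · exact (hP.adj v h).symm
  · refine isAcyclic_of_forall_adj_leaf ?_
    rintro u v (⟨h, rfl⟩ | ⟨h, rfl⟩)
    · exact Or.inl (hleaf u h)
    · exact Or.inr (hleaf v h)
  · intro v
    rcases hcov v with h | ⟨a, h, rfl⟩
    · exact ⟨f v, Or.inl ⟨h, rfl⟩⟩
    · exact ⟨a, Or.inr ⟨h, rfl⟩⟩
  · intro v
    by_cases hv : v ∈ A
    · exact (hleafset v hv).trans (by omega)
    · refine (card_le_card fun u hu => ?_).trans (hP.card_le v)
      exact mem_filter.2 (hcenter v hv u (mem_leafNeighbors.1 hu).1)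
  · intro s hs u hu
    by_cases hsA : s ∈ A
    · have := hleafset s hsA
      omega
    · refine mem_leafNeighbors.2 ⟨hu, fun w hw => ?_⟩
      obtain ⟨h1, h2⟩ := hcenter s hsA u hu
      rw [hleaf u h1 w hw, h2]

/-- Joining a leaf of a full star to a vertex outside the star that is not full leaves fewer full
vertices: the centre of the star loses a leaf, and no leaf is created. -/
lemma IsStarredForest.exists_card_fullVertices_lt {G F : SimpleGraph V} {k : ℕ} (hk : 1 ≤ k)
    (hF : IsStarredForest G F k) {s u w : V} (hs : s ∈ fullVertices F k)
    (hu : u ∈ leafNeighbors F s) (huw : G.Adj u w) (hws : w ≠ s) (hwl : w ∉ leafNeighbors F s)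
    (hwf : w ∉ fullVertices F k) :
    ∃ F', IsStarredForest G F' k ∧ #(fullVertices F' k) < #(fullVertices F k) := by
  have hs' := mem_fullVertices.1 hs
  have hne : u ≠ w := huw.ne
  set F' := F ⊔ SimpleGraph.edge u w with hF'
  have hle : F ≤ F' := le_sup_left
  have hadj : ∀ a b, F'.Adj a b ↔ F.Adj a b ∨ (a = u ∧ b = w) ∨ (a = w ∧ b = u) := by
    intro a b
    rw [hF', SimpleGraph.sup_adj, SimpleGraph.edge_adj]
    constructor
    · rintro (h | ⟨(⟨rfl, rfl⟩ | ⟨rfl, rfl⟩), _⟩) <;> tauto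
    · rintro (h | ⟨rfl, rfl⟩ | ⟨rfl, rfl⟩)
      · exact Or.inl h
      · exact Or.inr ⟨by tauto, hne⟩
      · exact Or.inr ⟨by tauto, hne.symm⟩
  have hsub := leafNeighbors_subset_of_le hle hF.exists_adj
  have hus : u ∉ leafNeighbors F' s := fun h =>
    hws ((mem_leafNeighbors.1 h).2 w ((hadj u w).2 (by tauto)))
  have hfull : ∀ v, #(leafNeighbors F' v) = k + 1 →
      #(leafNeighbors F v) = k + 1 ∧ leafNeighbors F' v = leafNeighbors F v := by
    intro v hv
    have h1 := card_le_card (hsub v)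
    have h2 := hF.card_le v
    exact ⟨by omega, eq_of_subset_of_card_le (hsub v) (by omega)⟩
  refine ⟨F', ⟨?_, ?_, ?_, ?_, ?_⟩, ?_⟩
  · intro a b hab
    rcases (hadj a b).1 hab with h | ⟨rfl, rfl⟩ | ⟨rfl, rfl⟩
    · exact hF.le h
    · exact huw
    · exact huw.symm
  · refine hF.isAcyclic.sup_edge_of_not_reachable
      (not_reachable_of_closed (insert s (leafNeighbors F s : Set V)) ?_ (Or.inr hu) ?_)
    · rintro a (rfl | ha) b hab
      · exact Or.inr (hF.full a hs' b hab)
      · exact Or.inl ((mem_leafNeighbors.1 ha).2 b hab)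
    · rintro (h | h)
      · exact hws h
      · exact hwl h
  · intro v
    obtain ⟨x, hx⟩ := hF.exists_adj v
    exact ⟨x, hle hx⟩
  · exact fun v => (card_le_card (hsub v)).trans (hF.card_le v)
  · intro v hv x hx
    obtain ⟨h1, h2⟩ := hfull v hv
    rw [h2]
    rcases (hadj v x).1 hx with h | ⟨rfl, rfl⟩ | ⟨rfl, rfl⟩
    · exact hF.full v h1 x h
    · exact absurd (mem_fullVertices.2 h1) (notMem_fullVertices_of_mem_leafNeighbors hk hu)
    · exact absurd (mem_fullVertices.2 h1) hwf
  · refine card_lt_card ⟨fun v hv => ?_, fun h => ?_⟩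
    · exact mem_fullVertices.2 (hfull v (mem_fullVertices.1 hv)).1
    · have := (hfull s (mem_fullVertices.1 (h hs))).2
      exact hus (this ▸ hu)

/-- Rotating a full star about a triangle: if the leaves `u`, `w` of the full vertex `s` are adjacent
in `G`, the edge `sw` may be replaced by `uw`. For `k ≥ 2` no vertex of the star is full any more;
for `k = 1` the component is a path on three vertices whose centre moves from `s` to `u`. -/
lemma IsStarredForest.exists_rotate {G F : SimpleGraph V} {k : ℕ} (hk : 1 ≤ k)
    (hF : IsStarredForest G F k) {s u w : V} (hs : s ∈ fullVertices F k)
    (hu : u ∈ leafNeighbors F s) (hw : w ∈ leafNeighbors F s) (huw : G.Adj u w) :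
    ∃ F', IsStarredForest G F' k ∧ s ∉ fullVertices F' k ∧
      fullVertices F' k ⊆ insert u ((fullVertices F k).erase s) ∧
      (∀ v ∈ fullVertices F k, v ≠ s → leafNeighbors F' v = leafNeighbors F v) ∧
      (2 ≤ k → u ∉ fullVertices F' k) ∧ (k = 1 → leafNeighbors F' u = {s, w}) := by
  have hs' := mem_fullVertices.1 hs
  have hne : u ≠ w := huw.ne
  obtain ⟨hsu, hu1⟩ := mem_leafNeighbors.1 hu
  obtain ⟨hsw, hw1⟩ := mem_leafNeighbors.1 hw
  set D := F.deleteEdges {s(s, w)} with hD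
  set F' := D ⊔ SimpleGraph.edge u w with hF'
  have hDadj : ∀ a b, D.Adj a b ↔ F.Adj a b ∧ a ≠ w ∧ b ≠ w := by
    intro a b
    rw [hD, SimpleGraph.deleteEdges_adj, Set.mem_singleton_iff, Sym2.eq_iff]
    refine and_congr_right fun h => ?_
    constructor
    · refine fun hn => ⟨?_, ?_⟩
      · rintro rfl
        exact hn (Or.inr ⟨rfl, hw1 b h⟩)
      · rintro rfl
        exact hn (Or.inl ⟨hw1 a h.symm, rfl⟩)
    · rintro ⟨h1, h2⟩ (⟨_, h⟩ | ⟨h, _⟩)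
      · exact h2 h
      · exact h1 h
  have hadj : ∀ a b, F'.Adj a b ↔
      (F.Adj a b ∧ a ≠ w ∧ b ≠ w) ∨ (a = u ∧ b = w) ∨ (a = w ∧ b = u) := by
    intro a b
    rw [hF', SimpleGraph.sup_adj, SimpleGraph.edge_adj, hDadj]
    constructor
    · rintro (h | ⟨(⟨rfl, rfl⟩ | ⟨rfl, rfl⟩), _⟩) <;> tauto
    · rintro (h | ⟨rfl, rfl⟩ | ⟨rfl, rfl⟩)
      · exact Or.inl h
      · exact Or.inr ⟨by tauto, hne⟩
      · exact Or.inr ⟨by tauto, hne.symm⟩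
  have hsu' : F'.Adj s u := (hadj s u).2 (Or.inl ⟨hsu, hsw.ne, hne⟩)
  have huw' : F'.Adj u w := (hadj u w).2 (by tauto)
  have hsw_ne : s ≠ w := hsw.ne
  have hsu_ne : s ≠ u := hsu.ne
  -- Away from `s`, `u`, `w` nothing changes.
  have hother : ∀ v, v ≠ s → v ≠ u → v ≠ w → ∀ x, F'.Adj v x ↔ F.Adj v x := by
    intro v h1 h2 h3 x
    rw [hadj]
    constructor
    · rintro (h | h | h)
      · exact h.1
      · exact absurd h.1 h2
      · exact absurd h.1 h3
    · refine fun h => Or.inl ⟨h, h3, ?_⟩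
      rintro rfl
      exact h1 (hw1 v h.symm)
  have hsub : ∀ v, v ≠ s → v ≠ u → v ≠ w → leafNeighbors F' v ⊆ leafNeighbors F v := by
    intro v h1 h2 h3 x hx
    obtain ⟨hvx, hx1⟩ := mem_leafNeighbors.1 hx
    have hvx' := (hother v h1 h2 h3 x).1 hvx
    have hxs : x ≠ s := by
      rintro rfl
      exact h2 (hx1 u hsu').symm
    have hxu : x ≠ u := by
      rintro rfl
      exact h1 (hu1 v hvx'.symm)
    have hxw : x ≠ w := by
      rintro rfl
      exact h1 (hw1 v hvx'.symm)
    exact mem_leafNeighbors.2 ⟨hvx', fun y hy => hx1 y ((hother x hxs hxu hxw y).2 hy)⟩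
  have hleafs : leafNeighbors F' s ⊆ (leafNeighbors F s).erase w := by
    intro x hx
    obtain ⟨hsx, -⟩ := mem_leafNeighbors.1 hx
    rcases (hadj s x).1 hsx with h | h | h
    · exact mem_erase.2 ⟨h.2.2, hF.full s hs' x h.1⟩
    · exact absurd h.1 hsu_ne
    · exact absurd h.1 hsw_ne
  have hcards : #(leafNeighbors F' s) ≤ k := by
    have h1 := card_le_card hleafs
    rw [card_erase_of_mem hw] at h1
    omega
  have hleafw : leafNeighbors F' w = ∅ := by
    refine eq_empty_of_forall_notMem fun x hx => ?_
    obtain ⟨hwx, hx1⟩ := mem_leafNeighbors.1 hx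
    rcases (hadj w x).1 hwx with h | h | h
    · exact h.2.1 rfl
    · exact hne h.1.symm
    · rw [h.2] at hx1
      exact hsw_ne (hx1 s hsu'.symm)
  have hadju : ∀ x, F'.Adj u x → x = s ∨ x = w := by
    intro x hx
    rcases (hadj u x).1 hx with h | h | h
    · exact Or.inl (hu1 x h.1)
    · exact Or.inr h.2
    · exact absurd h.1 hne
  have hleafu : leafNeighbors F' u ⊆ {s, w} := by
    intro x hx
    have := hadju x (mem_leafNeighbors.1 hx).1
    simpa using this
  have hwu : w ∈ leafNeighbors F' u := by
    refine mem_leafNeighbors.2 ⟨huw', fun x hx => ?_⟩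
    rcases (hadj w x).1 hx with h | h | h
    · exact absurd rfl h.2.1
    · exact absurd h.1 hne.symm
    · exact h.2
  have hk1 : k = 1 → leafNeighbors F' u = {s, w} := by
    rintro rfl
    refine Subset.antisymm hleafu fun x hx => ?_
    rcases mem_insert.1 hx with rfl | hx
    · refine mem_leafNeighbors.2 ⟨hsu'.symm, fun y hy => ?_⟩
      rcases (hadj x y).1 hy with h | h | h
      · by_contra hyu
        have h3 : ({u, w, y} : Finset V) ⊆ leafNeighbors F x := by
          intro z hz
          simp only [mem_insert, mem_singleton] at hz
          rcases hz with rfl | rfl | rfl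
          · exact hu
          · exact hw
          · exact hF.full x hs' z h.1
        have h4 := card_le_card h3
        rw [hs', card_eq_three.2 ⟨u, w, y, hne, Ne.symm hyu, h.2.2.symm, rfl⟩] at h4
        omega
      · exact absurd h.1 hsu_ne
      · exact absurd h.1 hsw_ne
    · rw [mem_singleton.1 hx]
      exact hwu
  -- For `k ≥ 2` the vertex `s` keeps a leaf besides `u`, so it is not a leaf of `u`.
  have hk2 : 2 ≤ k → #(leafNeighbors F' u) ≤ 1 := by
    intro hk2
    obtain ⟨x, hx, hxn⟩ : ∃ x ∈ leafNeighbors F s, x ∉ ({u, w} : Finset V) := by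
      by_contra hcon
      push Not at hcon
      have := card_le_card hcon
      rw [hs', card_pair hne] at this
      omega
    simp only [mem_insert, mem_singleton, not_or] at hxn
    refine (card_le_card (t := {w}) fun y hy => ?_).trans (card_singleton _).le
    rcases mem_insert.1 (hleafu hy) with rfl | h
    · refine absurd ((mem_leafNeighbors.1 hy).2 x ?_) hxn.1
      exact (hadj y x).2 (Or.inl ⟨(mem_leafNeighbors.1 hx).1, hsw_ne, hxn.2⟩)
    · exact h
  have hfull : ∀ v, v ≠ u → #(leafNeighbors F' v) = k + 1 →
      v ≠ s ∧ v ≠ w ∧ #(leafNeighbors F v) = k + 1 ∧ leafNeighbors F' v = leafNeighbors F v := by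
    intro v hvu hv
    have h1 : v ≠ s := by rintro rfl; omega
    have h2 : v ≠ w := by rintro rfl; simp [hleafw] at hv
    have h3 := card_le_card (hsub v h1 hvu h2)
    have h4 := hF.card_le v
    exact ⟨h1, h2, by omega, eq_of_subset_of_card_le (hsub v h1 hvu h2) (by omega)⟩
  refine ⟨F', ⟨?_, ?_, ?_, ?_, ?_⟩, ?_, ?_, ?_, ?_, hk1⟩
  · intro a b hab
    rcases (hadj a b).1 hab with h | ⟨rfl, rfl⟩ | ⟨rfl, rfl⟩
    · exact hF.le h.1
    · exact huw
    · exact huw.symm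
  · have hDac : D.IsAcyclic := hF.isAcyclic.anti (SimpleGraph.deleteEdges_le _)
    refine hDac.sup_edge_of_not_reachable (not_reachable_of_closed {w}ᶜ ?_ hne (by simp))
    intro a _ b hab
    exact ((hDadj a b).1 hab).2.2
  · intro v
    by_cases h1 : v = s
    · exact ⟨u, h1 ▸ hsu'⟩
    by_cases h2 : v = u
    · exact ⟨w, h2 ▸ huw'⟩
    by_cases h3 : v = w
    · exact ⟨u, h3 ▸ huw'.symm⟩
    obtain ⟨x, hx⟩ := hF.exists_adj v
    exact ⟨x, (hother v h1 h2 h3 x).2 hx⟩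
  · intro v
    by_cases h1 : v = s
    · rw [h1]; omega
    by_cases h2 : v = u
    · rw [h2]
      exact (card_le_card hleafu).trans (card_le_two.trans (by omega))
    by_cases h3 : v = w
    · simp [h3, hleafw]
    exact (card_le_card (hsub v h1 h2 h3)).trans (hF.card_le v)
  · intro v hv x hx
    by_cases h2 : v = u
    · subst h2
      have h5 := card_le_card hleafu
      rw [card_pair hsw_ne] at h5
      rw [hk1 (by omega)]
      simpa using hadju x hx
    · obtain ⟨h1, h3, h4, h5⟩ := hfull v h2 hv
      rw [h5]
      exact hF.full v h4 x ((hother v h1 h2 h3 x).1 hx)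
  · intro h
    have := mem_fullVertices.1 h
    omega
  · intro v hv
    by_cases h2 : v = u
    · simp [h2]
    · obtain ⟨h1, -, h4, -⟩ := hfull v h2 (mem_fullVertices.1 hv)
      exact mem_insert_of_mem (mem_erase.2 ⟨h1, mem_fullVertices.2 h4⟩)
  · intro v hv hvs
    have hvu : v ≠ u := by
      rintro rfl
      exact notMem_fullVertices_of_mem_leafNeighbors hk hu hv
    have hvw : v ≠ w := by
      rintro rfl
      exact notMem_fullVertices_of_mem_leafNeighbors hk hw hv
    refine Subset.antisymm (hsub v hvs hvu hvw) fun x hx => ?_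
    obtain ⟨hvx, hx1⟩ := mem_leafNeighbors.1 hx
    have hxs : x ≠ s := by
      rintro rfl
      exact notMem_fullVertices_of_mem_leafNeighbors hk hx hs
    have hxu : x ≠ u := by
      rintro rfl
      exact hvs (hu1 v hvx.symm)
    have hxw : x ≠ w := by
      rintro rfl
      exact hvs (hw1 v hvx.symm)
    exact mem_leafNeighbors.2 ⟨(hother v hvs hvu hvw x).2 hvx,
      fun y hy => hx1 y ((hother x hxs hxu hxw y).1 hy)⟩
  · intro h2 h
    have h3 := mem_fullVertices.1 h
    have h4 := hk2 h2
    omega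

end LeafDegree

/-! ### Kaneko's theorem -/

section Kaneko
open Classical
open Finset

variable {V : Type*} [Fintype V]

/-- Rotation in a starred forest with the least number of full vertices. -/
lemma IsStarredForest.exists_rotate_of_minimal {G F : SimpleGraph V} {k : ℕ} (hk : 1 ≤ k)
    (hF : IsStarredForest G F k)
    (hmin : ∀ F', IsStarredForest G F' k → #(fullVertices F k) ≤ #(fullVertices F' k))
    {s u w : V} (hs : s ∈ fullVertices F k) (hu : u ∈ leafNeighbors F s)
    (hw : w ∈ leafNeighbors F s) (huw : G.Adj u w) :
    ∃ F', IsStarredForest G F' k ∧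
      (∀ F'', IsStarredForest G F'' k → #(fullVertices F' k) ≤ #(fullVertices F'' k)) ∧
      s ∉ fullVertices F' k ∧ fullVertices F' k ⊆ insert u ((fullVertices F k).erase s) ∧
      (∀ v ∈ fullVertices F k, v ≠ s →
        v ∈ fullVertices F' k ∧ leafNeighbors F' v = leafNeighbors F v) ∧
      u ∈ fullVertices F' k ∧ leafNeighbors F' u = {s, w} := by
  obtain ⟨F', hF', h1, h2, h3, h4, h5⟩ := hF.exists_rotate hk hs hu hw huw
  have hle : #(fullVertices F' k) ≤ #(fullVertices F k) := by
    have h6 := (card_le_card h2).trans (card_insert_le _ _)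
    rwa [card_erase_add_one hs] at h6
  have hk1 : k = 1 := by
    by_contra hk1
    have h6 : fullVertices F' k ⊆ (fullVertices F k).erase s := by
      intro v hv
      rcases mem_insert.1 (h2 hv) with rfl | h
      · exact absurd hv (h4 (by omega))
      · exact h
    have h7 := card_le_card h6
    have h8 := hmin F' hF'
    rw [← card_erase_add_one hs] at h8
    omega
  refine ⟨F', hF', fun F'' hF'' => hle.trans (hmin F'' hF''), h1, h2,
    fun v hv hvs => ⟨?_, h3 v hv hvs⟩, ?_, h5 hk1⟩
  · rw [mem_fullVertices, h3 v hv hvs]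
    exact mem_fullVertices.1 hv
  · have hsw : s ≠ w := (mem_leafNeighbors.1 hw).1.ne
    rw [mem_fullVertices, h5 hk1, card_pair hsw, hk1]

/-- A starred forest with the least number of full vertices has none. Otherwise let `T` be the set
of full vertices no two leaves of which are adjacent in `G`. The leaves of the stars with centre in
`T` have all their `G`-neighbours in `T`, against Kaneko's condition, unless `T` is empty. If it is,
every full star spans a triangle, and some edge of the connected graph `G` leaves this triangle;
rotating the triangle makes the end of that edge a leaf, which can be joined to its other end. -/
lemma IsStarredForest.fullVertices_eq_empty {G F : SimpleGraph V} {k : ℕ} (hk : 1 ≤ k)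
    (hG : G.Connected) (hn : k + 3 ≤ Fintype.card V) (hK : IsolatesFewerThan G k)
    (hF : IsStarredForest G F k)
    (hmin : ∀ F', IsStarredForest G F' k → #(fullVertices F k) ≤ #(fullVertices F' k)) :
    fullVertices F k = ∅ := by
  set T := (fullVertices F k).filter fun s =>
    ∀ x ∈ leafNeighbors F s, ∀ y ∈ leafNeighbors F s, ¬ G.Adj x y with hT
  have hnotT : ∀ s ∈ fullVertices F k, s ∉ T →
      ∃ x ∈ leafNeighbors F s, ∃ y ∈ leafNeighbors F s, G.Adj x y := by
    intro s hs hsT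
    by_contra hcon
    push Not at hcon
    exact hsT (mem_filter.2 ⟨hs, hcon⟩)
  by_contra hne
  rcases T.eq_empty_or_nonempty with hTe | hTne
  · obtain ⟨s, hs⟩ := nonempty_iff_ne_empty.2 hne
    -- An edge `zw` of `G` leaving the star at `s`.
    obtain ⟨z, hz, w, hw, hzw⟩ : ∃ z ∈ insert s (leafNeighbors F s),
        ∃ w, w ∉ insert s (leafNeighbors F s) ∧ G.Adj z w := by
      by_contra hcon
      push Not at hcon
      obtain ⟨v, hv⟩ : ∃ v, v ∉ insert s (leafNeighbors F s) := by
        by_contra hall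
        push Not at hall
        have h1 := card_le_card (fun v _ => hall v : (univ : Finset V) ⊆ _)
        have h2 := card_insert_le s (leafNeighbors F s)
        rw [mem_fullVertices.1 hs] at h2
        rw [card_univ] at h1
        omega
      refine not_reachable_of_closed (F := G) (insert s (leafNeighbors F s) : Finset V) ?_
        (mem_insert_self s _) hv (hG.preconnected s v)
      intro a ha b hab
      by_contra hb
      exact hcon a ha b hb hab
    simp only [mem_insert, not_or] at hw
    -- The star at `w`, if any, is rotated so that `w` is not full.
    obtain ⟨F₁, hF₁, hmin₁, hs₁, hl₁, hw₁⟩ : ∃ F₁, IsStarredForest G F₁ k ∧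
        (∀ F', IsStarredForest G F' k → #(fullVertices F₁ k) ≤ #(fullVertices F' k)) ∧
        s ∈ fullVertices F₁ k ∧ leafNeighbors F₁ s = leafNeighbors F s ∧
        w ∉ fullVertices F₁ k := by
      by_cases hwf : w ∈ fullVertices F k
      · obtain ⟨x, hx, y, hy, hxy⟩ := hnotT w hwf (by simp [hTe])
        obtain ⟨F₁, hF₁, hmin₁, h1, -, h3, -⟩ :=
          hF.exists_rotate_of_minimal hk hmin hwf hx hy hxy
        exact ⟨F₁, hF₁, hmin₁, (h3 s hs (Ne.symm hw.1)).1, (h3 s hs (Ne.symm hw.1)).2, h1⟩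
      · exact ⟨F, hF, hmin, hs, rfl, hwf⟩
    rcases mem_insert.1 hz with rfl | hz
    · -- The end of the edge is the centre of the star: rotate the star.
      obtain ⟨x, hx, y, hy, hxy⟩ := hnotT z hs (by simp [hTe])
      rw [← hl₁] at hx hy hw
      obtain ⟨F₂, hF₂, hmin₂, -, h2, -, h4, h5⟩ :=
        hF₁.exists_rotate_of_minimal hk hmin₁ hs₁ hx hy hxy
      have hwx : w ≠ x := by
        rintro rfl
        exact hw.2 hx
      have hwy : w ≠ y := by
        rintro rfl
        exact hw.2 hy
      obtain ⟨F', hF', hlt⟩ := hF₂.exists_card_fullVertices_lt hk h4 (u := z) (w := w)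
        (by simp [h5]) hzw hwx (by simp [h5, hw.1, hwy]) (fun h => by
          rcases mem_insert.1 (h2 h) with h | h
          · exact hwx h
          · exact hw₁ (mem_of_mem_erase h))
      exact absurd (hmin₂ F' hF') (by omega)
    · rw [← hl₁] at hz hw
      obtain ⟨F', hF', hlt⟩ := hF₁.exists_card_fullVertices_lt hk hs₁ hz hzw hw.1 hw.2 hw₁
      exact absurd (hmin₁ F' hF') (by omega)
  · have hdisj : (T : Set V).PairwiseDisjoint (leafNeighbors F) := by
      intro s _ t _ hst
      rw [Function.onFun, Finset.disjoint_left]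
      intro u hu hu'
      exact hst ((mem_leafNeighbors.1 hu').2 s (mem_leafNeighbors.1 hu).1.symm)
    have hcard : #(T.biUnion (leafNeighbors F)) = (k + 1) * #T := by
      rw [card_biUnion hdisj, sum_congr rfl (fun s hs => mem_fullVertices.1 (mem_filter.1 hs).1),
        sum_const, smul_eq_mul, mul_comm]
    refine absurd (hK T (T.biUnion (leafNeighbors F)) hTne ?_ ?_) (by omega)
    · rw [Finset.disjoint_left]
      intro u hu huT
      obtain ⟨s, -, hus⟩ := mem_biUnion.1 hu
      exact notMem_fullVertices_of_mem_leafNeighbors hk hus (mem_filter.1 huT).1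
    · intro u hu w huw
      obtain ⟨s, hsT, hus⟩ := mem_biUnion.1 hu
      obtain ⟨hs, htri⟩ := mem_filter.1 hsT
      by_cases hws : w = s
      · exact hws ▸ hsT
      have hwl : w ∉ leafNeighbors F s := fun h => htri u hus w h huw
      by_cases hwf : w ∈ fullVertices F k
      · by_contra hwT
        obtain ⟨x, hx, y, hy, hxy⟩ := hnotT w hwf hwT
        obtain ⟨F₁, hF₁, hmin₁, h1, -, h3, -⟩ :=
          hF.exists_rotate_of_minimal hk hmin hwf hx hy hxy
        obtain ⟨h4, h5⟩ := h3 s hs (Ne.symm hws)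
        rw [← h5] at hus hwl
        obtain ⟨F', hF', hlt⟩ := hF₁.exists_card_fullVertices_lt hk h4 hus huw hws hwl h1
        exact absurd (hmin₁ F' hF') (by omega)
      · obtain ⟨F', hF', hlt⟩ := hF.exists_card_fullVertices_lt hk hs hus huw hws hwl hwf
        exact absurd (hmin F' hF') (by omega)

/-- Kaneko's theorem: a connected graph in which every nonempty vertex set `S` isolates fewer than
`(k + 1)|S|` vertices has a spanning tree of leaf degree at most `k`. The bound on the order
excludes the triangle, which for `k = 1` satisfies the condition but has no such tree. -/
theorem IsolatesFewerThan.exists_isSpanningTree {G : SimpleGraph V} {k : ℕ} (hk : 1 ≤ k)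
    (hG : G.Connected) (hn : k + 3 ≤ Fintype.card V) (hK : IsolatesFewerThan G k) :
    ∃ T : SimpleGraph V, IsSpanningTree G T ∧ leafDegree T ≤ k := by
  have : Nontrivial V := Fintype.one_lt_card_iff_nontrivial.1 (by omega)
  obtain ⟨g, hg, hfib⟩ := hK.exists_neighbor_map fun v => hG.preconnected.exists_adj_of_nontrivial v
  obtain ⟨A, f, hP, hcov⟩ := exists_isStarPacking_cover (by omega) g hg hfib
  obtain ⟨F₀, hF₀⟩ := hP.exists_isStarredForest hk hcov
  obtain ⟨F, hF, hmin⟩ := Set.exists_min_image {F | IsStarredForest G F k}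
    (fun F => #(fullVertices F k)) (Set.toFinite _) ⟨F₀, hF₀⟩
  have hempty := IsStarredForest.fullVertices_eq_empty hk hG hn hK hF hmin
  refine exists_isSpanningTree_leafDegree_le hG hF.le hF.isAcyclic hF.exists_adj fun v => ?_
  have h1 := hF.card_le v
  have h2 : #(leafNeighbors F v) ≠ k + 1 := fun h => by
    have := mem_fullVertices.2 h
    simp [hempty] at this
  omega

end Kaneko

/-! ### The largest eigenvalue of `A_a` -/

section SpectralRadius
open Classical
open Finset Matrix

variable {V : Type*} [Fintype V]

lemma aMatrix_mulVec (a : ℝ) (G : SimpleGraph V) (x : V → ℝ) (i : V) :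
    (aMatrix a G *ᵥ x) i = ∑ j, if G.Adj i j then a * x i + x j else 0 := by
  have hdeg : (G.degree i : ℝ) = ∑ j, if G.Adj i j then (1 : ℝ) else 0 := by
    rw [← SimpleGraph.card_neighborFinset_eq_degree, SimpleGraph.neighborFinset_eq_filter]
    simp
  rw [aMatrix, add_mulVec, Pi.add_apply, smul_mulVec, Pi.smul_apply, SimpleGraph.degMatrix,
    mulVec_diagonal, smul_eq_mul, hdeg, sum_mul, mul_sum, SimpleGraph.adjMatrix_mulVec_apply,
    SimpleGraph.neighborFinset_eq_filter, sum_filter, ← sum_add_distrib]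
  refine sum_congr rfl fun j _ => ?_
  split_ifs <;> ring

lemma dotProduct_aMatrix_mulVec_comm (a : ℝ) (G : SimpleGraph V) (x y : V → ℝ) :
    x ⬝ᵥ aMatrix a G *ᵥ y = y ⬝ᵥ aMatrix a G *ᵥ x := by
  have h : (aMatrix a G)ᵀ = aMatrix a G := by
    simpa [IsHermitian, conjTranspose_eq_transpose_of_trivial] using aMatrix_isHermitian a G
  rw [dotProduct_mulVec, ← mulVec_transpose, h, dotProduct_comm]

lemma posSemidef_rhoA_sub [Nonempty V] (a : ℝ) (G : SimpleGraph V) :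
    (rhoA a G • (1 : Matrix V V ℝ) - aMatrix a G).PosSemidef := by
  have hH : (rhoA a G • (1 : Matrix V V ℝ) - aMatrix a G).IsHermitian := by
    refine IsHermitian.sub ?_ (aMatrix_isHermitian a G)
    simp [IsHermitian]
  rw [hH.posSemidef_iff_eigenvalues_nonneg]
  intro i
  have hv := hH.mulVec_eigenvectorBasis i
  set v : V → ℝ := (hH.eigenvectorBasis i).ofLp with hvdef
  have hv0 : v ≠ 0 := by
    intro h
    apply hH.eigenvectorBasis.toBasis.ne_zero i
    ext j
    simpa using congrFun h j
  have heig : Module.End.HasEigenvalue (mulVecLin (aMatrix a G))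
      (rhoA a G - hH.eigenvalues i) := by
    refine Module.End.hasEigenvalue_of_hasEigenvector (x := v)
      ⟨Module.End.mem_eigenspace_iff.2 ?_, hv0⟩
    rw [sub_mulVec, smul_mulVec, one_mulVec] at hv
    rw [mulVecLin_apply, sub_smul, ← hv]
    abel
  have := (rhoA_isGreatest a G).2 heig
  simpa using this

/-- The Rayleigh bound. -/
lemma dotProduct_aMatrix_mulVec_le [Nonempty V] (a : ℝ) (G : SimpleGraph V) (x : V → ℝ) :
    x ⬝ᵥ aMatrix a G *ᵥ x ≤ rhoA a G * (x ⬝ᵥ x) := by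
  have h := (posSemidef_rhoA_sub a G).dotProduct_mulVec_nonneg x
  rw [sub_mulVec, smul_mulVec, one_mulVec, dotProduct_sub, dotProduct_smul, star_trivial,
    smul_eq_mul] at h
  linarith

/-- The absolute value of an eigenvector for the largest eigenvalue attains the Rayleigh bound, so it
is an eigenvector too. -/
lemma exists_nonneg_eigenvector [Nonempty V] (a : ℝ) (G : SimpleGraph V) :
    ∃ x : V → ℝ, (∀ i, 0 ≤ x i) ∧ x ≠ 0 ∧ aMatrix a G *ᵥ x = rhoA a G • x := by
  obtain ⟨y, hy, hy0⟩ := (rhoA_isGreatest a G).1.exists_hasEigenvector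
  rw [Module.End.mem_eigenspace_iff, mulVecLin_apply] at hy
  set x : V → ℝ := fun i => |y i| with hx
  refine ⟨x, fun i => abs_nonneg _, fun h => hy0 ?_, ?_⟩
  · ext i
    simpa [hx] using congrFun h i
  · have hxx : x ⬝ᵥ x = y ⬝ᵥ y := by simp [dotProduct, hx]
    have hle : y ⬝ᵥ aMatrix a G *ᵥ y ≤ x ⬝ᵥ aMatrix a G *ᵥ x := by
      simp only [dotProduct, aMatrix_mulVec, mul_sum]
      refine sum_le_sum fun i _ => sum_le_sum fun j _ => ?_
      split_ifs
      · have h1 : |y i| * |y i| = y i * y i := abs_mul_abs_self _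
        have h2 : y i * y j ≤ |y i| * |y j| := by rw [← abs_mul]; exact le_abs_self _
        simp only [hx]
        linear_combination h2 - a * h1
      · simp
    have hge := dotProduct_aMatrix_mulVec_le a G x
    rw [hy, dotProduct_smul, smul_eq_mul, ← hxx] at hle
    have hz := ((posSemidef_rhoA_sub a G).dotProduct_mulVec_zero_iff x).1 (by
      rw [sub_mulVec, smul_mulVec, one_mulVec, dotProduct_sub, dotProduct_smul, star_trivial,
        smul_eq_mul]
      linarith)
    rw [sub_mulVec, smul_mulVec, one_mulVec] at hz
    exact (sub_eq_zero.1 hz).symm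

lemma exists_pos_eigenvector {G : SimpleGraph V} (hG : G.Connected) (a : ℝ) :
    ∃ x : V → ℝ, (∀ i, 0 < x i) ∧ aMatrix a G *ᵥ x = rhoA a G • x := by
  have := hG.nonempty
  obtain ⟨x, hx, hx0, hxe⟩ := exists_nonneg_eigenvector a G
  refine ⟨x, fun i => lt_of_le_of_ne (hx i) fun hi => hx0 ?_, hxe⟩
  ext j
  by_contra hj
  -- The zero set of `x` is closed under adjacency.
  refine not_reachable_of_closed (F := G) {v | x v = 0} ?_ hi.symm hj (hG.preconnected i j)
  intro u hu v huv
  have hu' : x u = 0 := hu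
  have h1 := congrFun hxe u
  rw [aMatrix_mulVec, Pi.smul_apply, hu', smul_zero, sum_eq_zero_iff_of_nonneg] at h1
  · simpa [huv] using h1 v (mem_univ v)
  · intro w _
    split_ifs
    · simpa using hx w
    · exact le_rfl

/-- The Collatz–Wielandt upper bound. -/
lemma rhoA_le_of_mulVec_le [Nonempty V] (a : ℝ) (G : SimpleGraph V) {x : V → ℝ} {l : ℝ}
    (hx : ∀ i, 0 < x i) (h : ∀ i, (aMatrix a G *ᵥ x) i ≤ l * x i) : rhoA a G ≤ l := by
  obtain ⟨z, hz, hz0, hze⟩ := exists_nonneg_eigenvector a G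
  have hpos : 0 < z ⬝ᵥ x := by
    obtain ⟨i, hi⟩ := Function.ne_iff.1 hz0
    exact sum_pos' (fun j _ => mul_nonneg (hz j) (hx j).le)
      ⟨i, mem_univ i, mul_pos (lt_of_le_of_ne (hz i) (Ne.symm hi)) (hx i)⟩
  have h1 : z ⬝ᵥ aMatrix a G *ᵥ x ≤ l * (z ⬝ᵥ x) := by
    simp only [dotProduct, mul_sum]
    refine sum_le_sum fun i _ => ?_
    have := mul_le_mul_of_nonneg_left (h i) (hz i)
    linarith
  rw [dotProduct_aMatrix_mulVec_comm, hze, dotProduct_smul, dotProduct_comm, smul_eq_mul] at h1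
  exact le_of_mul_le_mul_right h1 hpos

/-- The strict Collatz–Wielandt lower bound. -/
lemma lt_rhoA_of_le_mulVec (a : ℝ) (G : SimpleGraph V) {x : V → ℝ} {l : ℝ}
    (hx : ∀ i, 0 < x i) (h : ∀ i, l * x i ≤ (aMatrix a G *ᵥ x) i)
    {v : V} (hv : l * x v < (aMatrix a G *ᵥ x) v) : l < rhoA a G := by
  have : Nonempty V := ⟨v⟩
  have hpos : 0 < x ⬝ᵥ x := sum_pos (fun j _ => mul_pos (hx j) (hx j)) ⟨v, mem_univ v⟩
  have h1 : l * (x ⬝ᵥ x) < x ⬝ᵥ aMatrix a G *ᵥ x := by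
    simp only [dotProduct, mul_sum]
    refine sum_lt_sum (fun i _ => ?_) ⟨v, mem_univ v, ?_⟩
    · have := mul_le_mul_of_nonneg_left (h i) (hx i).le
      linarith
    · have := mul_lt_mul_of_pos_left hv (hx v)
      linarith
  exact lt_of_mul_lt_mul_right (h1.trans_le (dotProduct_aMatrix_mulVec_le a G x)) hpos.le

/-- A connected graph that embeds as a proper spanning subgraph has smaller spectral radius: the
Perron vector of the subgraph is a test vector for the larger graph. -/
lemma rhoA_lt_of_bijective {W : Type*} [Fintype W] {G : SimpleGraph V} {H : SimpleGraph W} {a : ℝ}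
    (ha : 0 ≤ a) (hG : G.Connected) (e : V ≃ W) (hle : ∀ u v, G.Adj u v → H.Adj (e u) (e v))
    {u v : V} (huv : ¬ G.Adj u v) (huv' : H.Adj (e u) (e v)) : rhoA a G < rhoA a H := by
  obtain ⟨x, hx, hxe⟩ := exists_pos_eigenvector hG a
  have hH : ∀ i, (aMatrix a H *ᵥ (x ∘ e.symm)) (e i) =
      ∑ j, if H.Adj (e i) (e j) then a * x i + x j else 0 := by
    intro i
    rw [aMatrix_mulVec, ← e.sum_comp]
    simp
  have hterm : ∀ i j, (if G.Adj i j then a * x i + x j else 0) ≤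
      if H.Adj (e i) (e j) then a * x i + x j else 0 := by
    intro i j
    have h0 : 0 ≤ a * x i + x j := add_nonneg (mul_nonneg ha (hx i).le) (hx j).le
    by_cases h : G.Adj i j
    · simp [h, hle i j h]
    · rw [if_neg h]
      split_ifs
      · exact h0
      · exact le_rfl
  have hGi : ∀ i, rhoA a G * x i = ∑ j, if G.Adj i j then a * x i + x j else 0 := by
    intro i
    rw [← aMatrix_mulVec, hxe, Pi.smul_apply, smul_eq_mul]
  refine lt_rhoA_of_le_mulVec a H (x := x ∘ e.symm) (v := e u) (fun i => hx _) (fun i => ?_) ?_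
  · obtain ⟨i, rfl⟩ := e.surjective i
    rw [hH, Function.comp_apply, e.symm_apply_apply, hGi]
    exact sum_le_sum fun j _ => hterm i j
  · rw [hH, Function.comp_apply, e.symm_apply_apply, hGi]
    refine sum_lt_sum (fun j _ => hterm u j) ⟨v, mem_univ v, ?_⟩
    rw [if_neg huv, if_pos huv']
    exact add_pos_of_nonneg_of_pos (mul_nonneg ha (hx u).le) (hx v)

end SpectralRadius

/-! ### The extremal graph -/

section Extremal
open Classical
open Finset Matrix

/-- The clique of order `n - k - 1` inside the extremal graph gives the bound, and the pendant
vertices make it strict. -/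
lemma lt_rhoA_extremalGraph {n k : ℕ} (hn : k + 3 ≤ n) {a : ℝ} (ha0 : 0 ≤ a) (ha1 : a ≤ 1) :
    (1 + a) * ((n : ℝ) - k - 2) < rhoA a (extremalGraph n k) := by
  obtain ⟨q, hq⟩ : ∃ q, n - k - 2 = q + 1 := ⟨n - k - 3, by omega⟩
  have hcast : (n : ℝ) - k - 2 = q + 1 := by
    have : n = q + 1 + k + 2 := by omega
    rw [this]; push_cast; ring
  rw [hcast, extremalGraph, hq]
  set H := graphJoin (⊤ : SimpleGraph (Fin 1))
    ((⊤ : SimpleGraph (Fin (q + 1))).sum (⊥ : SimpleGraph (Fin (k + 1)))) with hH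
  -- Small enough for the inequality `(1 + a)(q + 1)ε ≤ 1` at the pendant vertices.
  set ε : ℝ := 1 / (2 * (q + 1)) with hε
  have hq0 : (0 : ℝ) ≤ q := Nat.cast_nonneg q
  have hk0 : (0 : ℝ) ≤ k := Nat.cast_nonneg k
  have hεpos : 0 < ε := by positivity
  have hε1 : 2 * (q + 1) * ε = 1 := by rw [hε]; field_simp
  set x : Fin 1 ⊕ (Fin (q + 1) ⊕ Fin (k + 1)) → ℝ :=
    Sum.elim (fun _ => 1) (Sum.elim (fun _ => 1) fun _ => ε) with hx
  have hcenter : ∀ c, (aMatrix a H *ᵥ x) (Sum.inl c) = (q + 1) * (a + 1) + (k + 1) * (a + ε) := by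
    intro c
    rw [aMatrix_mulVec]
    simp [hH, graphJoin, hx, Fintype.sum_sum_type, Subsingleton.elim c 0]
    ring
  have hclique : ∀ i, (aMatrix a H *ᵥ x) (Sum.inr (Sum.inl i)) = (q + 1) * (a + 1) := by
    intro i
    have hrow : ∀ j, (if H.Adj (Sum.inr (Sum.inl i)) j then
        a * x (Sum.inr (Sum.inl i)) + x j else 0) = Sum.elim (fun _ => a + 1)
          (Sum.elim (fun j => (a + 1) - if i = j then a + 1 else 0) fun _ => 0) j := by
      rintro (j | j | j)
      · simp [hH, graphJoin, hx]
      · by_cases h : i = j <;> simp [hH, graphJoin, hx, h]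
      · simp [hH, graphJoin]
    rw [aMatrix_mulVec, sum_congr rfl fun j _ => hrow j]
    simp [Fintype.sum_sum_type]
    ring
  have hpendant : ∀ j, (aMatrix a H *ᵥ x) (Sum.inr (Sum.inr j)) = a * ε + 1 := by
    intro j
    rw [aMatrix_mulVec]
    simp [hH, graphJoin, hx, Fintype.sum_sum_type]
  have hstrict : (1 + a) * (q + 1) * x (Sum.inl 0) < (aMatrix a H *ᵥ x) (Sum.inl 0) := by
    rw [hcenter, hx, Sum.elim_inl]
    have : 0 < ((k : ℝ) + 1) * (a + ε) := by positivity
    linarith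
  refine lt_rhoA_of_le_mulVec a H (x := x) (v := Sum.inl 0) ?_ ?_ hstrict
  · rintro (i | i | i)
    · simp [hx]
    · simp [hx]
    · simpa [hx] using hεpos
  · rintro (i | i | i)
    · rw [Subsingleton.elim i 0]
      exact hstrict.le
    · rw [hclique]
      simp only [hx, Sum.elim_inr, Sum.elim_inl]
      linarith
    · rw [hpendant]
      simp only [hx, Sum.elim_inr]
      have h1 : 0 ≤ a * ε := mul_nonneg ha0 hεpos.le
      have h2 : (1 + a) * ((q + 1) * ε) ≤ 2 * ((q + 1) * ε) :=
        mul_le_mul_of_nonneg_right (by linarith) (by positivity)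
      linarith

variable {V : Type*} [Fintype V]

/-- An upper bound on the spectral radius of a graph in which `S` isolates the vertices of `I`, from
the test vector with value `p` on `S`, `q` on `I` and `1` elsewhere. -/
lemma rhoA_le_of_isolates (G : SimpleGraph V) {S I : Finset V} (hIS : Disjoint I S)
    (hnbr : ∀ u ∈ I, ∀ w, G.Adj u w → w ∈ S) {a p q l m : ℝ} (ha : 0 ≤ a) (hp : 0 < p)
    (hq : 0 < q) [Nonempty V] (hm : (Fintype.card V : ℝ) = #S + #I + m)
    (hS : a * p * (Fintype.card V - 1) + (#S - 1) * p + m + #I * q ≤ l * p)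
    (hI : #S * (a * q + p) ≤ l * q) (hR : a * (#S + m - 1) + #S * p + m - 1 ≤ l) :
    rhoA a G ≤ l := by
  set x : V → ℝ := fun i => if i ∈ S then p else if i ∈ I then q else 1 with hx
  have hpos : ∀ i, 0 < x i := by
    intro i
    simp only [hx]
    split_ifs <;> linarith
  have hrow : ∀ i, ∀ B : Finset V, (∀ j, G.Adj i j → j ∈ B) →
      (aMatrix a G *ᵥ x) i ≤ #B * (a * x i) + ∑ j ∈ B, x j := by
    intro i B hB
    rw [aMatrix_mulVec, ← sum_filter, ← nsmul_eq_mul, ← sum_const, ← sum_add_distrib]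
    refine sum_le_sum_of_subset_of_nonneg (fun j hj => hB j (mem_filter.1 hj).2) fun j _ _ => ?_
    exact add_nonneg (mul_nonneg ha (hpos i).le) (hpos j).le
  have hxS : ∑ j ∈ S, x j = #S * p := by
    rw [sum_congr rfl (fun j hj => if_pos hj), sum_const, nsmul_eq_mul]
  have hxI : ∑ j ∈ I, x j = #I * q := by
    rw [sum_congr rfl (g := fun _ => q), sum_const, nsmul_eq_mul]
    intro j hj
    simp [hx, Finset.disjoint_left.1 hIS hj, hj]
  have hcardR : (#(univ \ I) : ℝ) = #S + m := by
    have h1 : (#(univ \ I) : ℝ) + #I = Fintype.card V := by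
      exact_mod_cast card_sdiff_add_card_eq_card (subset_univ I)
    linarith
  have hSR : S ⊆ univ \ I := fun j hj =>
    mem_sdiff.2 ⟨mem_univ j, Finset.disjoint_right.1 hIS hj⟩
  have hxR : ∑ j ∈ univ \ I, x j = #S * p + m := by
    rw [← sum_sdiff hSR, hxS, sum_congr rfl (g := fun _ => (1 : ℝ)), sum_const, nsmul_eq_mul,
      mul_one]
    · have h1 : (#((univ \ I) \ S) : ℝ) + #S = #(univ \ I) := by
        exact_mod_cast card_sdiff_add_card_eq_card hSR
      linarith
    · intro j hj
      simp only [mem_sdiff, mem_univ, true_and] at hj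
      simp [hx, hj.1, hj.2]
  have hxV : ∑ j, x j = #S * p + m + #I * q := by
    rw [← sum_sdiff (subset_univ I), hxR, hxI]
  refine rhoA_le_of_mulVec_le a G hpos fun i => ?_
  by_cases hiS : i ∈ S
  · have hxi : x i = p := by simp [hx, hiS]
    have h := hrow i (univ.erase i) fun j hj => mem_erase.2 ⟨hj.ne', mem_univ j⟩
    have h1 : (#(univ.erase i) : ℝ) + 1 = Fintype.card V := by
      exact_mod_cast card_erase_add_one (mem_univ i)
    have h2 := add_sum_erase univ x (mem_univ i)
    rw [hxi] at h h2 ⊢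
    have h3 : (#(univ.erase i) : ℝ) = Fintype.card V - 1 := by linarith
    rw [h3] at h
    linarith
  by_cases hiI : i ∈ I
  · have hxi : x i = q := by simp [hx, hiS, hiI]
    have h := hrow i S fun j hj => hnbr i hiI j hj
    rw [hxi, hxS] at h
    rw [hxi]
    linarith
  · have hxi : x i = 1 := by simp [hx, hiS, hiI]
    have hiR : i ∈ univ \ I := mem_sdiff.2 ⟨mem_univ i, hiI⟩
    have h := hrow i ((univ \ I).erase i) fun j hj => mem_erase.2 ⟨hj.ne', mem_sdiff.2
      ⟨mem_univ j, fun hjI => hiS (hnbr j hjI i hj.symm)⟩⟩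
    have h1 : (#((univ \ I).erase i) : ℝ) + 1 = #(univ \ I) := by
      exact_mod_cast card_erase_add_one hiR
    have h2 := add_sum_erase (univ \ I) x hiR
    rw [hxi] at h h2 ⊢
    have h3 : (#((univ \ I).erase i) : ℝ) = #S + m - 1 := by linarith
    rw [h3] at h
    linarith

/-- If at least two vertices isolate `k + 1` times as many vertices, the spectral radius is at most
that of a clique of order `n - k - 1`. The weight on `S` is chosen so that the inequality at the
vertices outside `S ∪ I` is an equality, the weight on `I` so that the one on `I` is. -/
lemma rhoA_le_of_two_le_card (G : SimpleGraph V) {S I : Finset V} {k : ℕ} (hk : 1 ≤ k)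
    (hn : 2 * k + 12 ≤ Fintype.card V) (hIS : Disjoint I S)
    (hnbr : ∀ u ∈ I, ∀ w, G.Adj u w → w ∈ S) (hcard : #I = (k + 1) * #S) (hS : 2 ≤ #S) {a : ℝ}
    (ha : a = 0 ∨ a = 1) : rhoA a G ≤ (1 + a) * ((Fintype.card V : ℝ) - k - 2) := by
  have : Nonempty V := Fintype.card_pos_iff.1 (by omega)
  have hle : #I + #S ≤ Fintype.card V := by
    rw [← card_union_of_disjoint hIS]
    exact card_le_univ _
  obtain ⟨m', hm'⟩ := Nat.exists_eq_add_of_le hle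
  -- The bound on the order is needed for `|S| = 2` only: it leaves eight further vertices.
  have hcase : (#S = 2 ∧ 8 ≤ m') ∨ 3 ≤ #S := by
    rcases hS.eq_or_lt with h | h
    · refine Or.inl ⟨h.symm, ?_⟩
      rw [← h] at hcard hm'
      omega
    · exact Or.inr h
  set s : ℝ := (#S : ℝ) with hs
  set c : ℝ := (k : ℝ) + 1 with hc
  set m : ℝ := (m' : ℝ) with hm
  have hI : (#I : ℝ) = c * s := by rw [hcard]; push_cast; rfl
  have hN : (Fintype.card V : ℝ) = s + c * s + m := by
    rw [hm', Nat.cast_add, Nat.cast_add, hI]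
    ring
  have hkc : (k : ℝ) = c - 1 := by simp [hc]
  have hc2 : 2 ≤ c := by
    have : (1 : ℝ) ≤ k := by exact_mod_cast hk
    linarith
  have hs2 : 2 ≤ s := by rw [hs]; exact_mod_cast hS
  have hm0 : 0 ≤ m := Nat.cast_nonneg m'
  have hcase' : (s = 2 ∧ 8 ≤ m) ∨ 3 ≤ s := by
    rcases hcase with ⟨h1, h2⟩ | h
    · exact Or.inl ⟨by rw [hs, h1]; norm_num, by rw [hm]; exact_mod_cast h2⟩
    · exact Or.inr (by rw [hs]; exact_mod_cast h)
  have hc1 : 2 * (s - 1) ≤ c * (s - 1) := mul_le_mul_of_nonneg_right hc2 (by linarith)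
  have hNm : (Fintype.card V : ℝ) = #S + #I + m := by rw [hN, hI]
  rcases ha with rfl | rfl
  · set P : ℝ := s + c * (s - 1) with hP
    set L : ℝ := m + P - 1 with hL
    have hPpos : 0 < P := by linarith
    have hLpos : 0 < L := by linarith
    have hp : P / s * s = P := div_mul_cancel₀ _ (by linarith)
    have hq : P / L * L = P := div_mul_cancel₀ _ hLpos.ne'
    have key : s ^ 2 * P ≤ (s - 1) * L * (L + 1) := by
      rcases hcase' with ⟨h1, h2⟩ | h
      · rw [h1] at hP ⊢
        nlinarith
      · have h1 : s ^ 2 ≤ (s - 1) * (P - 1) := by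
          rw [hP]
          nlinarith
        have h2 : (s - 1) * (P - 1) * P ≤ (s - 1) * L * (L + 1) := by
          rw [mul_assoc, mul_assoc]
          refine mul_le_mul_of_nonneg_left ?_ (by linarith)
          exact mul_le_mul (by linarith) (by linarith) hPpos.le hLpos.le
        have h3 := mul_le_mul_of_nonneg_right h1 hPpos.le
        linarith
    have hmain : m + c * s * (P / L) ≤ (m + c * (s - 1)) * (P / s) := by
      refine le_of_mul_le_mul_right ?_ (mul_pos (by linarith : 0 < s) hLpos)
      have e1 : (m + c * s * (P / L)) * (s * L) = m * s * L + c * s ^ 2 * P := by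
        linear_combination c * s ^ 2 * hq
      have e2 : (m + c * (s - 1)) * (P / s) * (s * L) = (m + c * (s - 1)) * P * L := by
        linear_combination (m + c * (s - 1)) * L * hp
      rw [e1, e2]
      have h3 := mul_le_mul_of_nonneg_left key (by linarith : 0 ≤ c)
      have e3 : (m + c * (s - 1)) * P * L - (m * s * L + c * s ^ 2 * P) =
          c * ((s - 1) * L * (L + 1)) - c * (s ^ 2 * P) := by
        rw [hL, hP]; ring
      linarith
    refine rhoA_le_of_isolates G hIS hnbr le_rfl (p := P / s) (q := P / L) (m := m)
      (div_pos hPpos (by linarith)) (div_pos hPpos hLpos) hNm ?_ ?_ ?_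
    · rw [hI, hN, hkc]
      have : (1 + 0) * (s + c * s + m - (c - 1) - 2) = m + c * (s - 1) + (s - 1) := by ring
      rw [this]
      linarith
    · rw [hN, hkc]
      have : (1 + 0) * (s + c * s + m - (c - 1) - 2) = L := by rw [hL, hP]; ring
      rw [this]
      linarith
    · rw [hN, hkc]
      linarith
  · set P : ℝ := s + 2 * c * (s - 1) with hP
    set M : ℝ := 2 * m + P - 2 with hM
    have hPs : 6 ≤ P := by linarith
    have hMpos : 0 < M := by linarith
    have hp : P / s * s = P := div_mul_cancel₀ _ (by linarith)
    have hq : P / M * M = P := div_mul_cancel₀ _ hMpos.ne'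
    have key : s ^ 2 * P ≤ M * (2 * (s - 1) * m + (s - 2) * P) := by
      rcases hcase' with ⟨h1, h2⟩ | h
      · have h3 : P * 4 ≤ M * (2 * m) :=
          mul_le_mul (by linarith) (by linarith) (by norm_num) hMpos.le
        rw [h1]
        linarith
      · have h1 : s ^ 2 ≤ (P - 2) * (s - 2) := by
          have h4 : 4 * (s - 1) ≤ 2 * c * (s - 1) := by linarith
          have h5 : (5 * s - 6) * (s - 2) ≤ (P - 2) * (s - 2) :=
            mul_le_mul_of_nonneg_right (by linarith) (by linarith)
          nlinarith
        have h2 := mul_le_mul_of_nonneg_right h1 (by linarith : 0 ≤ P)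
        have h3 : (P - 2) * ((s - 2) * P) ≤ M * (2 * (s - 1) * m + (s - 2) * P) := by
          have h4 : 0 ≤ (s - 1) * m := mul_nonneg (by linarith) hm0
          have h5 : 0 ≤ (s - 2) * P := mul_nonneg (by linarith) (by linarith)
          exact mul_le_mul (by linarith) (by linarith) h5 hMpos.le
        linarith
    have hmain : m + c * s * (P / M) ≤ (m + c * (s - 2)) * (P / s) := by
      refine le_of_mul_le_mul_right ?_ (mul_pos (by linarith : 0 < s) hMpos)
      have e1 : (m + c * s * (P / M)) * (s * M) = m * s * M + c * s ^ 2 * P := by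
        linear_combination c * s ^ 2 * hq
      have e2 : (m + c * (s - 2)) * (P / s) * (s * M) = (m + c * (s - 2)) * P * M := by
        linear_combination (m + c * (s - 2)) * M * hp
      rw [e1, e2]
      have h3 := mul_le_mul_of_nonneg_left key (by linarith : 0 ≤ c)
      have e3 : (m + c * (s - 2)) * P * M - (m * s * M + c * s ^ 2 * P) =
          c * (M * (2 * (s - 1) * m + (s - 2) * P)) - c * (s ^ 2 * P) := by
        rw [hM, hP]; ring
      linarith
    have hl : (1 + 1) * (s + c * s + m - (c - 1) - 2) = M + s := by rw [hM, hP]; ring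
    refine rhoA_le_of_isolates G hIS hnbr zero_le_one (p := P / s) (q := P / M) (m := m)
      (div_pos (by linarith) (by linarith)) (div_pos (by linarith) hMpos) hNm ?_ ?_ ?_
    · rw [hI, hN, hkc]
      have : (1 + 1) * (s + c * s + m - (c - 1) - 2) =
          m + c * (s - 2) + (s + c * s + m - 1) + (s - 1) := by ring
      rw [this]
      linarith
    · rw [hN, hkc, hl]
      linarith
    · rw [hN, hkc, hl]
      linarith

/-- If a single vertex isolates `k + 1` vertices, then `G` is a spanning subgraph of the extremal
graph. -/
lemma exists_equiv_extremalGraph (G : SimpleGraph V) {S I : Finset V} {k : ℕ}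
    (hn : k + 2 ≤ Fintype.card V) (hIS : Disjoint I S)
    (hnbr : ∀ u ∈ I, ∀ w, G.Adj u w → w ∈ S) (hI : #I = k + 1) (hS : #S = 1) :
    ∃ e : V ≃ Fin 1 ⊕ (Fin (Fintype.card V - k - 2) ⊕ Fin (k + 1)),
      ∀ u v, G.Adj u v → (extremalGraph (Fintype.card V) k).Adj (e u) (e v) := by
  have hR : #(univ \ (I ∪ S)) = Fintype.card V - k - 2 := by
    rw [card_sdiff_of_subset (subset_univ _), card_univ, card_union_of_disjoint hIS]
    omega
  have eS := (S.equivFinOfCardEq hS).symm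
  have eI := (I.equivFinOfCardEq hI).symm
  have eR := ((univ \ (I ∪ S)).equivFinOfCardEq hR).symm
  let φ : Fin 1 ⊕ (Fin (Fintype.card V - k - 2) ⊕ Fin (k + 1)) → V :=
    Sum.elim (fun i => eS i) (Sum.elim (fun i => eR i) fun i => eI i)
  have hφS : ∀ i, φ (Sum.inl i) ∈ S := fun i => (eS i).2
  have hφI : ∀ i, φ (Sum.inr (Sum.inr i)) ∈ I := fun i => (eI i).2
  have hφR : ∀ i, φ (Sum.inr (Sum.inl i)) ∉ I ∧ φ (Sum.inr (Sum.inl i)) ∉ S := by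
    intro i
    have : (eR i : V) ∉ I ∧ (eR i : V) ∉ S := by
      simpa only [mem_union, not_or] using (mem_sdiff.1 (eR i).2).2
    exact this
  have hφIS : ∀ i, φ (Sum.inr (Sum.inr i)) ∉ S := fun i => Finset.disjoint_left.1 hIS (hφI i)
  have hinj : Function.Injective φ := by
    rintro (i | i | i) (j | j | j) h
    · rw [eS.injective (Subtype.ext h)]
    · exact absurd (h ▸ hφS i) (hφR j).2
    · exact absurd (h ▸ hφS i) (hφIS j)
    · exact absurd (h ▸ hφS j) (hφR i).2
    · rw [eR.injective (Subtype.ext h)]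
    · exact absurd (h ▸ hφI j) (hφR i).1
    · exact absurd (h ▸ hφS j) (hφIS i)
    · exact absurd (h ▸ hφI i) (hφR j).1
    · rw [eI.injective (Subtype.ext h)]
  have hbij : Function.Bijective φ := by
    refine (Fintype.bijective_iff_injective_and_card φ).2 ⟨hinj, ?_⟩
    simp only [Fintype.card_sum, Fintype.card_fin]
    omega
  have hadj : ∀ i j, G.Adj (φ i) (φ j) → (extremalGraph (Fintype.card V) k).Adj i j := by
    rintro (i | i | i) (j | j | j) h
    · rw [Subsingleton.elim i j] at h
      exact absurd h (G.irrefl)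
    · trivial
    · trivial
    · trivial
    · have hij : i ≠ j := by
        rintro rfl
        exact G.irrefl h
      simpa [extremalGraph, graphJoin] using hij
    · exact absurd (hnbr _ (hφI j) _ h.symm) (hφR i).2
    · trivial
    · exact absurd (hnbr _ (hφI i) _ h) (hφR j).2
    · exact absurd (hnbr _ (hφI i) _ h) (hφIS j)
  refine ⟨(Equiv.ofBijective φ hbij).symm, fun u v h => hadj _ _ ?_⟩
  have hid : ∀ u, φ ((Equiv.ofBijective φ hbij).symm u) = u :=
    (Equiv.ofBijective φ hbij).apply_symm_apply
  rwa [hid, hid]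

/-- The pendant vertices of the extremal graph are leaves of each spanning tree, all adjacent to the
centre. -/
lemma lt_leafDegree_of_iso_extremalGraph {G T : SimpleGraph V} {n k : ℕ}
    (φ : G ≃g extremalGraph n k) (hT : IsSpanningTree G T) : k < leafDegree T := by
  set c := φ.symm (Sum.inl 0) with hc
  let v : Fin (k + 1) → V := fun j => φ.symm (Sum.inr (Sum.inr j))
  have hv : Function.Injective v := fun i j h => by simpa [v] using h
  have hpendant : ∀ j w, T.Adj (v j) w → w = c := by
    intro j w h
    have h1 := φ.map_adj_iff.2 (hT.1 h)
    simp only [v, RelIso.apply_symm_apply] at h1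
    rw [hc, RelIso.eq_symm_apply]
    rcases hw : φ w with i | i | i
    · rw [Subsingleton.elim i 0]
    · rw [hw] at h1
      simp [extremalGraph, graphJoin] at h1
    · rw [hw] at h1
      simp [extremalGraph, graphJoin] at h1
  have : Nontrivial V := ⟨v 0, c, by simp [v, hc]⟩
  have hleaf : univ.image v ⊆ leafNeighbors T c := by
    intro u hu
    obtain ⟨j, -, rfl⟩ := mem_image.1 hu
    obtain ⟨w, hw⟩ := hT.2.connected.preconnected.exists_adj_of_nontrivial (v j)
    obtain rfl := hpendant j w hw
    exact mem_leafNeighbors.2 ⟨hw.symm, hpendant j⟩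
  have h1 := card_le_card hleaf
  rw [card_image_of_injective _ hv, card_univ, Fintype.card_fin,
    ← vertexLeafDegree_eq_card_leafNeighbors] at h1
  exact h1.trans (Finset.le_sup (f := fun v => vertexLeafDegree T v) (mem_univ c))

end Extremal

theorem mainTheorem2 {V : Type*} [Fintype V] (G : SimpleGraph V) (n k : ℕ) (a : ℝ)
    (hG : G.Connected) (hn : Fintype.card V = n) (hk : 1 ≤ k) (hnk : 2 * k + 12 ≤ n)
    (ha : a = 0 ∨ a = 1) (hrho : rhoA a (extremalGraph n k) ≤ rhoA a G) :
    (∃ T : SimpleGraph V, IsSpanningTree G T ∧ leafDegree T ≤ k) ↔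
      ¬ Nonempty (G ≃g extremalGraph n k) := by
  subst hn
  have ha0 : 0 ≤ a := by rcases ha with rfl | rfl <;> norm_num
  have ha1 : a ≤ 1 := by rcases ha with rfl | rfl <;> norm_num
  constructor
  · rintro ⟨T, hT, hle⟩ ⟨φ⟩
    exact absurd (lt_leafDegree_of_iso_extremalGraph φ hT) (by omega)
  intro hiso
  by_contra hno
  have hK : ¬ IsolatesFewerThan G k := fun hK =>
    hno (hK.exists_isSpanningTree hk hG (by omega))
  simp only [IsolatesFewerThan, not_forall, not_lt] at hK
  obtain ⟨S, I', hS, hIS', hnbr', hcard'⟩ := hK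
  obtain ⟨I, hI, hcard⟩ := Finset.exists_subset_card_eq hcard'
  have hIS : Disjoint I S := Finset.disjoint_of_subset_left hI hIS'
  have hnbr : ∀ u ∈ I, ∀ w, G.Adj u w → w ∈ S := fun u hu => hnbr' u (hI hu)
  rcases (Nat.succ_le_of_lt hS.card_pos).eq_or_lt with h1 | h2
  · obtain ⟨e, he⟩ := exists_equiv_extremalGraph (k := k) G (by omega) hIS hnbr
      (by rw [hcard, ← h1]; simp) h1.symm
    by_cases hall : ∀ u v, (extremalGraph (Fintype.card V) k).Adj (e u) (e v) → G.Adj u v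
    · exact hiso ⟨⟨e, fun {u v} => ⟨hall u v, he u v⟩⟩⟩
    · push Not at hall
      obtain ⟨u, v, h, h'⟩ := hall
      exact absurd hrho (rhoA_lt_of_bijective ha0 hG e he h' h).not_ge
  · have h3 := rhoA_le_of_two_le_card G hk hnk hIS hnbr hcard h2 ha
    have h4 := lt_rhoA_extremalGraph (n := Fintype.card V) (k := k) (by omega) ha0 ha1
    exact absurd hrho (h3.trans_lt h4).not_ge
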